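/- **Theorem 2.1.** Let $G$ be a finite simple bipartite graph with partite sets $X$ and $Y$ (so $V(G)=X\sqcup Y$ and every edge joins $X$ to $Y$). The following are equivalent: 1. $G$ is a unit interval bigraph; 2. $G$ is a proper interval bigraph; 3. $G$ is a class-proper interval 2-graph; 4. $G$ is a permutation graph; 5. $V(G)$ can be ordered $(v_1,\dots,v_n)$ so that whenever $v_iv_k\in E(G)$ and $i<j<k$, $v_j$ is adjacent to whichever of $v_i,v_k$ is not in its partite set; 6. $G$ has a strong ordering; 7. the bipartite adjacency matrix of $G$ has a monotone consecutive arrangement; 8. $G$ is the comparability graph of a poset of dimension at most $2$; 9. $G$ is the incomparability graph of a poset of dimension at most $2$; 10. the complement $\overline G$ is a proper circular arc graph; 11. $G$ contains no asteroidal triple. Here an *interval $2$-representation* of $G$ assigns to each vertex $v$ a nonempty closed interval $I_v=[L(v),R(v)]\subset\mathbb R$ and one of at most two classes so that $uv\in E(G)$ if and only if $I_u\cap I_v\ne\emptyset$ and $u,v$ are in different classes. $G$ is a *unit interval bigraph*, a *proper interval bigraph*, or a *class-proper interval 2-graph* if it has an interval $2$-representation in which, respectively, all intervals have the same length; no interval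 properly contains another; no interval properly contains another interval of the same class. A *permutation graph* is the intersection graph of a family of line segments, each joining a point of $L_1$ to a point of $L_2$, where $L_1,L_2$ are two distinct parallel lines. A *strong ordering* consists of linear orders of $X$ and of $Y$ such that for all edges $xy$, $x'y'$ with $x,x'\in X$, $y,y'\in Y$, $x<x'$ and $y'<y$, both $xy'$ and $x'y$ are edges. The *bipartite adjacency matrix* is the $(0,1)$-matrix with rows indexed by $X$ and columns by $Y$ whose $(x,y)$ entry is $1$ if and only if $xy\in E(G)$; a $(0,1)$-matrix has a *monotone consecutive arrangement* if its rows and columns can be permuted independently, and its zeros then labelled $R$ or $C$, so that every position above or to the right of an $R$ is an $R$ and every position below or to the left of a $C$ is a $C$. The *dimension* of a poset is the least number of linear orders whose intersection is the given order; two distinct vertices are adjacent in the comparability (resp. incomparability) graph of a poset on the vertex set if and only if they are comparable (resp. incomparable). A *proper circular arc graph* is the intersection graph of a family of arcs of a circle none of which properly contains another. An *asteroidal triple* is a set of three distinct vertices such that any two of them are joined by a path containing no neighbour of the third. -/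

import Mathlib

namespace IntervalBigraph

/-! ### Interval `k`-graphs -/

/-- An interval `k`-representation of `G`: every vertex `v` receives a nonempty closed interval
`[left v, right v]` of the real line and one of (at most) `k` classes, and two vertices are
adjacent iff their intervals meet and belong to different classes. -/
structure IntervalRep {V : Type*} (G : SimpleGraph V) (k : ℕ) where
  left : V → ℝ
  right : V → ℝ
  left_le_right : ∀ v, left v ≤ right v
  cls : V → Fin k
  adj_iff : ∀ u v, G.Adj u v ↔
    cls u ≠ cls v ∧ (Set.Icc (left u) (right u) ∩ Set.Icc (left v) (right v)).Nonempty

/-- The interval representing the vertex `v`. -/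
def IntervalRep.interval {V : Type*} {G : SimpleGraph V} {k : ℕ} (ρ : IntervalRep G k) (v : V) :
    Set ℝ :=
  Set.Icc (ρ.left v) (ρ.right v)

/-- `G` is an interval 2-graph with a representation by intervals of identical length. -/
def IsUnitIntervalBigraph {V : Type*} (G : SimpleGraph V) : Prop :=
  ∃ ρ : IntervalRep G 2, ∃ len : ℝ, ∀ v, ρ.right v - ρ.left v = len

/-- `G` is an interval 2-graph with a representation in which no interval properly contains
another. -/
def IsProperIntervalBigraph {V : Type*} (G : SimpleGraph V) : Prop :=
  ∃ ρ : IntervalRep G 2, ∀ u v, ¬ ρ.interval u ⊂ ρ.interval v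

/-- `G` is an interval `k`-graph with a representation in which no interval properly contains
another interval of its own class. -/
def IsClassProperIntervalGraph {V : Type*} (G : SimpleGraph V) (k : ℕ) : Prop :=
  ∃ ρ : IntervalRep G k, ∀ u v, ρ.cls u = ρ.cls v → ¬ ρ.interval u ⊂ ρ.interval v

/-! ### Permutation graphs -/

/-- `G` is the intersection graph of line segments joining two parallel lines (the channels, here
the horizontal lines at heights `0` and `1` of the plane); `p v` and `q v` are the abscissas of the
endpoints on the two channels of the segment of `v`. -/
def IsPermutationGraph {V : Type*} (G : SimpleGraph V) : Prop :=
  ∃ p q : V → ℝ, ∀ u v, G.Adj u v ↔ u ≠ v ∧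
    (segment ℝ ((p u, 0) : ℝ × ℝ) (q u, 1) ∩ segment ℝ ((p v, 0) : ℝ × ℝ) (q v, 1)).Nonempty

/-! ### Orderings of a bipartite graph with partite sets `X` and `Y` -/

/-- `u` and `v` lie in different partite sets. -/
def InDifferentParts {V : Type*} (X Y : Set V) (u v : V) : Prop :=
  (u ∈ X ∧ v ∈ Y) ∨ (u ∈ Y ∧ v ∈ X)

/-- The vertices can be linearly ordered (`pos v` is the position of `v`) so that whenever `u w` is
an edge and `v` is strictly between `u` and `w`, then `v` is adjacent to whichever of `u`, `w` is
not in its partite set. -/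
def HasUmbrellaOrdering {V : Type*} (G : SimpleGraph V) (X Y : Set V) : Prop :=
  ∃ pos : V ≃ Fin (Nat.card V), ∀ u v w, pos u < pos v → pos v < pos w → G.Adj u w →
    (InDifferentParts X Y v u → G.Adj v u) ∧ (InDifferentParts X Y v w → G.Adj v w)

/-- A strong ordering: linear orders of the two partite sets such that for all edges `x y`, `x' y'`
with `x < x'` and `y' < y`, also `x y'` and `x' y` are edges. -/
def HasStrongOrdering {V : Type*} (G : SimpleGraph V) (X Y : Set V) : Prop :=
  ∃ (r : X ≃ Fin (Nat.card X)) (s : Y ≃ Fin (Nat.card Y)), ∀ (x x' : X) (y y' : Y),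
    G.Adj x y → G.Adj x' y' → r x < r x' → s y' < s y → G.Adj x y' ∧ G.Adj x' y

/-! ### Monotone consecutive arrangements -/

open Classical in
/-- The bipartite adjacency matrix: rows indexed by `X`, columns by `Y`. -/
noncomputable def biadjMatrix {V : Type*} (G : SimpleGraph V) (X Y : Set V) : Matrix X Y ℕ :=
  Matrix.of fun x y => if G.Adj x y then 1 else 0

/-- A (0,1)-matrix has a monotone consecutive arrangement if its rows and its columns can be
permuted independently (`r i` and `s j` are the new positions of row `i` and column `j`), and its
zeros can then be labelled `R` or `C`, in such a way that every position to the right of or above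
an `R` is an `R`, and every position to the left of or below a `C` is a `C`. Rows are
numbered downwards and columns from left to right. -/
def HasMonotoneConsecutiveArrangement {m n : Type*} (A : Matrix m n ℕ) : Prop :=
  ∃ (r : m ≃ Fin (Nat.card m)) (s : n ≃ Fin (Nat.card n)) (R C : Set (m × n)),
    Disjoint R C ∧
    (∀ i j, A i j = 0 ↔ (i, j) ∈ R ∨ (i, j) ∈ C) ∧
    (∀ i j i' j', (i, j) ∈ R → r i' ≤ r i → s j ≤ s j' → (i', j') ∈ R) ∧
    (∀ i j i' j', (i, j) ∈ C → r i ≤ r i' → s j' ≤ s j → (i', j') ∈ C)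

/-! ### Strict partial orders and their dimension -/

/-- The comparability graph of a strict partial order. -/
def comparabilityGraph {V : Type*} (lt : V → V → Prop) : SimpleGraph V where
  Adj u v := u ≠ v ∧ (lt u v ∨ lt v u)
  symm := ⟨fun _ _ h => ⟨h.1.symm, h.2.symm⟩⟩
  loopless := ⟨fun _ h => h.1 rfl⟩

/-- The incomparability graph of a strict partial order. -/
def incomparabilityGraph {V : Type*} (lt : V → V → Prop) : SimpleGraph V where
  Adj u v := u ≠ v ∧ ¬ lt u v ∧ ¬ lt v u
  symm := ⟨fun _ _ h => ⟨h.1.symm, h.2.2, h.2.1⟩⟩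
  loopless := ⟨fun _ h => h.1 rfl⟩

/-- A family of strict linear orders whose intersection is the strict order `lt`. -/
def IsRealizer {V ι : Type*} (lt : V → V → Prop) (L : ι → V → V → Prop) : Prop :=
  (∀ i, IsStrictTotalOrder V (L i)) ∧ ∀ u v, lt u v ↔ ∀ i, L i u v

/-- The (Dushnik-Miller) dimension of a strict partial order: the least number of strict linear
orders whose intersection is the order. -/
noncomputable def orderDim {V : Type*} (lt : V → V → Prop) : ℕ∞ :=
  ⨅ (d : ℕ) (_ : ∃ L : Fin d → V → V → Prop, IsRealizer lt L), (d : ℕ∞)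

def IsComparabilityGraphOfDimLE {V : Type*} (G : SimpleGraph V) (d : ℕ) : Prop :=
  ∃ lt : V → V → Prop, IsStrictOrder V lt ∧ orderDim lt ≤ d ∧ G = comparabilityGraph lt

def IsIncomparabilityGraphOfDimLE {V : Type*} (G : SimpleGraph V) (d : ℕ) : Prop :=
  ∃ lt : V → V → Prop, IsStrictOrder V lt ∧ orderDim lt ≤ d ∧ G = incomparabilityGraph lt

/-! ### Proper circular arc graphs -/

/-- The closed arc of the circle `ℝ / ℤ` which starts at `a` and runs in the positive direction
to `b`, where `a ≤ b < a + 1`. -/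
def arc (a b : ℝ) : Set UnitAddCircle :=
  (fun x : ℝ => (x : UnitAddCircle)) '' Set.Icc a b

/-- `H` is the intersection graph of a family of arcs of a circle, none of which properly contains
another. -/
def IsProperCircularArcGraph {V : Type*} (H : SimpleGraph V) : Prop :=
  ∃ a b : V → ℝ, (∀ v, a v ≤ b v ∧ b v < a v + 1) ∧
    (∀ u v, H.Adj u v ↔ u ≠ v ∧ (arc (a u) (b u) ∩ arc (a v) (b v)).Nonempty) ∧
    ∀ u v, ¬ arc (a u) (b u) ⊂ arc (a v) (b v)

/-! ### Asteroidal triples -/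

/-- There is a path from `u` to `v` containing no neighbour of `w`. -/
def PathAvoiding {V : Type*} (G : SimpleGraph V) (u v w : V) : Prop :=
  ∃ P : G.Walk u v, P.IsPath ∧ ∀ z ∈ P.support, ¬ G.Adj w z

/-- Three distinct vertices, any two of which are joined by a path containing no neighbour of the
third (in particular no two of them are adjacent). -/
def IsAsteroidalTriple {V : Type*} (G : SimpleGraph V) (u v w : V) : Prop :=
  u ≠ v ∧ v ≠ w ∧ u ≠ w ∧
    PathAvoiding G u v w ∧ PathAvoiding G v w u ∧ PathAvoiding G w u v

end IntervalBigraph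

namespace IntervalBigraph

variable {V : Type*}

/-! Everything passes through one hub: a bipartite graph in this class is the incomparability graph
of a strict order, with no bound on its dimension (`IsCocomparabilityGraph`). Such an order can be
stretched along the real line: removing a suitable maximal vertex and inducting places the vertices
so that vertices of different parts are adjacent exactly when their coordinates differ by less than
`1` (`IsCocomparabilityGraph.nonempty_unitCoord`). From these coordinates the concrete models are
read off by shifts and scaling: unit intervals, segments between two channels, the umbrella
ordering, realizers by two linear orders, and proper circular arcs for the complement.

Conversely, permutation graphs and both dimension conditions give a strict order directly. A
class-proper representation sorted by left endpoints gives a strong ordering, as does an umbrella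
ordering. A strong ordering gives a monotone consecutive arrangement, whose labels `R` and `C` tell
which of a nonadjacent pair lies below the other in a strict order.

For the last two conditions, a parity count of arc endpoints shows that a proper circular arc
complement excludes asteroidal triples. Without asteroidal triples, each component has a root with
respect to which no two vertices are unrelated. In every breadth-first level from such a root, the
neighbourhoods one level up and one level down are nested in opposite directions, so sorting by
component, level and degree difference is a strong ordering. -/

/-- `G` is a cocomparability graph: the incomparability graph of some strict partial order. -/
def IsCocomparabilityGraph (G : SimpleGraph V) : Prop :=
  ∃ lt : V → V → Prop, IsStrictOrder V lt ∧ G = incomparabilityGraph lt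

/-! ### Sorting a finite type by a key -/

theorem exists_equiv_fin_of_key {α ι : Type*} [Finite α] [LinearOrder ι] (f : α → ι) :
    ∃ r : α ≃ Fin (Nat.card α), ∀ a b, r a < r b → f a ≤ f b := by
  let e := Finite.equivFin α
  refine ⟨e.trans (Tuple.sort (f ∘ e.symm)).symm, fun a b h => ?_⟩
  simpa using Tuple.monotone_sort (f ∘ e.symm) h.le

/-- The key may have ties, which the sort breaks arbitrarily; hence the exchange property is
required for weak inequalities. -/
theorem hasStrongOrdering_of_key [Finite V] {G : SimpleGraph V} {X Y : Set V} {ι : Type*}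
    [LinearOrder ι] (f : V → ι)
    (h : ∀ x ∈ X, ∀ x' ∈ X, ∀ y ∈ Y, ∀ y' ∈ Y, G.Adj x y → G.Adj x' y' → f x ≤ f x' →
      f y' ≤ f y → G.Adj x y' ∧ G.Adj x' y) :
    HasStrongOrdering G X Y := by
  obtain ⟨r, hr⟩ := exists_equiv_fin_of_key fun x : X => f x
  obtain ⟨s, hs⟩ := exists_equiv_fin_of_key fun y : Y => f y
  exact ⟨r, s, fun x x' y y' hxy hxy' hx hy =>
    h x x.2 x' x'.2 y y.2 y' y'.2 hxy hxy' (hr _ _ hx) (hs _ _ hy)⟩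

/-! ### Strong orderings and monotone consecutive arrangements -/

/-- This moves isolated vertices to the end. A zero row between two nonzero rows, or such a column,
could make a consistent labelling impossible. -/
theorem exists_equiv_fin_last {α : Type*} [Finite α] {n : ℕ} (r : α ≃ Fin n) (p : α → Prop) :
    ∃ r' : α ≃ Fin (Nat.card α), (∀ a b, r' a < r' b → ¬ p b → ¬ p a) ∧
      ∀ a b, r' a < r' b → ¬ p b → r a < r b := by
  classical
  obtain ⟨r', h⟩ := exists_equiv_fin_of_key fun a => toLex (if p a then 1 else 0, (r a : ℕ))
  have key : ∀ a b, r' a < r' b → ¬ p b → ¬ p a ∧ r a < r b := by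
    intro a b hab hb
    have hne : r a ≠ r b := fun e => hab.ne (congrArg r' (r.injective e))
    have hne' : (r a : ℕ) ≠ r b := fun e => hne (Fin.ext e)
    have := h a b hab
    rw [Prod.Lex.toLex_le_toLex] at this
    by_cases ha : p a
    · simp [ha, hb] at this
    · refine ⟨ha, ?_⟩
      simp only [ha, hb, if_false, lt_self_iff_false, false_or, true_and] at this
      exact lt_of_le_of_ne this hne
  exact ⟨r', fun a b h hb => (key a b h hb).1, fun a b h hb => (key a b h hb).2⟩

theorem HasStrongOrdering.hasMonotoneConsecutiveArrangement [Finite V] {G : SimpleGraph V}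
    {X Y : Set V} (h : HasStrongOrdering G X Y) :
    HasMonotoneConsecutiveArrangement (biadjMatrix G X Y) := by
  obtain ⟨r₀, s₀, h⟩ := h
  obtain ⟨r, hr, hr'⟩ := exists_equiv_fin_last r₀ fun x : X => ∀ y : Y, ¬ G.Adj x y
  obtain ⟨s, hs, hs'⟩ := exists_equiv_fin_last s₀ fun y : Y => ∀ x : X, ¬ G.Adj x y
  have hrle : ∀ a b : X, r a ≤ r b → (∃ y : Y, G.Adj b y) → ∃ y : Y, G.Adj a y := by
    rintro a b hab hb
    rcases hab.lt_or_eq with hab | hab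
    · have := hr a b hab
      push Not at this
      exact this hb
    · rwa [r.injective hab]
  have hsle : ∀ a b : Y, s a ≤ s b → (∃ x : X, G.Adj x b) → ∃ x : X, G.Adj x a := by
    rintro a b hab hb
    rcases hab.lt_or_eq with hab | hab
    · have := hs a b hab
      push Not at this
      exact this hb
    · rwa [s.injective hab]
  have hcross : ∀ (x x' : X) (y y' : Y), G.Adj x y → G.Adj x' y' → r x ≤ r x' → s y' ≤ s y →
      G.Adj x y' ∧ G.Adj x' y := by
    intro x x' y y' hxy hxy' hx hy
    rcases hx.lt_or_eq with hx | hx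
    · rcases hy.lt_or_eq with hy | hy
      · exact h x x' y y' hxy hxy' (hr' _ _ hx fun hn => hn _ hxy') (hs' _ _ hy fun hn => hn _ hxy)
      · obtain rfl := s.injective hy
        exact ⟨hxy, hxy'⟩
    · obtain rfl := r.injective hx
      exact ⟨hxy', hxy⟩
  have hzero : ∀ (x : X) (y : Y), biadjMatrix G X Y x y = 0 ↔ ¬ G.Adj x y := by
    intro x y
    simp [biadjMatrix]
  -- `R` consists of the positions with no one weakly above and to the right; `C` takes all other
  -- zeros. Closure of `R` is then immediate, and only closure of `C` needs the strong ordering.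
  refine ⟨r, s, {p | ∀ (x : X) (y : Y), r x ≤ r p.1 → s p.2 ≤ s y → ¬ G.Adj x y},
    {p | ¬ G.Adj p.1 p.2 ∧ ∃ (x : X) (y : Y), r x ≤ r p.1 ∧ s p.2 ≤ s y ∧ G.Adj x y}, ?_, ?_, ?_, ?_⟩
  · rw [Set.disjoint_left]
    rintro p hp ⟨-, x, y, hx, hy, hxy⟩
    exact hp x y hx hy hxy
  · intro x y
    rw [hzero]
    simp only [Set.mem_ofPred_eq]
    constructor
    · intro hxy
      by_cases hex : ∃ (x' : X) (y' : Y), r x' ≤ r x ∧ s y ≤ s y' ∧ G.Adj x' y'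
      · exact Or.inr ⟨hxy, hex⟩
      · push Not at hex
        exact Or.inl hex
    · rintro (hR | hC)
      · exact hR x y le_rfl le_rfl
      · exact hC.1
  · intro x y x' y' hR hx hy x'' y'' hx' hy'
    exact hR x'' y'' (hx'.trans hx) (hy.trans hy')
  · rintro x y x' y' ⟨hxy, x₁, y₁, hx₁, hy₁, h₁⟩ hx hy
    dsimp only at *
    refine ⟨fun hxy' => hxy ?_, x₁, y₁, hx₁.trans hx, hy.trans hy₁, h₁⟩
    -- Isolated vertices come last, so row `x` and column `y` each contain a one. With the ones at
    -- `(x₁, y₁)` and `(x', y')`, repeated exchange forces a one at `(x, y)`.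
    obtain ⟨y₂, h₂⟩ := hrle x x' hx ⟨y', hxy'⟩
    obtain ⟨x₂, h₃⟩ := hsle y y₁ hy₁ ⟨x₁, h₁⟩
    -- the row `x` has an entry to the right of `y`, or the column `y` an entry above `x`
    rcases le_total (s y) (s y₂) with h | h
    · have h₄ := (hcross x x' y₂ y' h₂ hxy' hx (hy.trans h)).1
      rcases le_total (r x₂) (r x) with h' | h'
      · exact (hcross x₂ x y y' h₃ h₄ h' hy).2
      · exact (hcross x x₂ y₂ y h₂ h₃ h' h).1
    · have h₄ := (hcross x₁ x y₁ y₂ h₁ h₂ hx₁ (h.trans hy₁)).2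
      rcases le_total (r x₂) (r x) with h' | h'
      · exact (hcross x₂ x y y₂ h₃ h₂ h' h).2
      · exact (hcross x x₂ y₁ y h₄ h₃ h' hy₁).1

/-- Order each part as a chain, and put `x` below `y` at a zero labelled `R`, above it at a zero
labelled `C`. Transitivity amounts to the closure rules of the labels together with their
disjointness; the ones are the incomparable pairs. -/
theorem HasMonotoneConsecutiveArrangement.isCocomparabilityGraph {G : SimpleGraph V} {X Y : Set V}
    (hG : G.IsBipartiteWith X Y) (hXY : X ∪ Y = Set.univ)
    (h : HasMonotoneConsecutiveArrangement (biadjMatrix G X Y)) : IsCocomparabilityGraph G := by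
  obtain ⟨r, s, R, C, hRC, hA, hR, hC⟩ := h
  have hzero : ∀ (x : X) (y : Y), ¬ G.Adj x y ↔ (x, y) ∈ R ∨ (x, y) ∈ C := by
    intro x y
    rw [← hA]
    simp [biadjMatrix]
  have hRC' : ∀ p, p ∈ R → p ∉ C := fun _ h => Set.disjoint_left.1 hRC h
  have hdisj : ∀ v, v ∈ X → v ∉ Y := fun _ h => Set.disjoint_left.1 hG.disjoint h
  let lt : V → V → Prop := fun u v =>
    (∃ (hu : u ∈ X) (hv : v ∈ X), r ⟨u, hu⟩ < r ⟨v, hv⟩) ∨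
    (∃ (hu : u ∈ Y) (hv : v ∈ Y), s ⟨u, hu⟩ < s ⟨v, hv⟩) ∨
    (∃ (hu : u ∈ X) (hv : v ∈ Y), (⟨u, hu⟩, ⟨v, hv⟩) ∈ R) ∨
    (∃ (hu : u ∈ Y) (hv : v ∈ X), (⟨v, hv⟩, ⟨u, hu⟩) ∈ C)
  have hirr : ∀ u, ¬ lt u u := by
    rintro u (⟨hu, _, h⟩ | ⟨hu, _, h⟩ | ⟨hu, hv, h⟩ | ⟨hu, hv, h⟩)
    · exact lt_irrefl _ h
    · exact lt_irrefl _ h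
    · exact hdisj _ hu hv
    · exact hdisj _ hv hu
  have htrans : ∀ u v w, lt u v → lt v w → lt u w := by
    rintro u v w (⟨hu, hv, h⟩ | ⟨hu, hv, h⟩ | ⟨hu, hv, h⟩ | ⟨hu, hv, h⟩)
      (⟨hv', hw, h'⟩ | ⟨hv', hw, h'⟩ | ⟨hv', hw, h'⟩ | ⟨hv', hw, h'⟩)
    · exact Or.inl ⟨hu, hw, h.trans h'⟩
    · exact (hdisj _ hv hv').elim
    · exact Or.inr (Or.inr (Or.inl ⟨hu, hw, hR _ _ _ _ h' h.le le_rfl⟩))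
    · exact (hdisj _ hv hv').elim
    · exact (hdisj _ hv' hv).elim
    · exact Or.inr (Or.inl ⟨hu, hw, h.trans h'⟩)
    · exact (hdisj _ hv' hv).elim
    · exact Or.inr (Or.inr (Or.inr ⟨hu, hw, hC _ _ _ _ h' le_rfl h.le⟩))
    · exact (hdisj _ hv' hv).elim
    · exact Or.inr (Or.inr (Or.inl ⟨hu, hw, hR _ _ _ _ h le_rfl h'.le⟩))
    · exact (hdisj _ hv' hv).elim
    · exact Or.inl ⟨hu, hw, lt_of_not_ge fun hle => hRC' _ (hR _ _ _ _ h hle le_rfl) h'⟩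
    · exact Or.inr (Or.inr (Or.inr ⟨hu, hw, hC _ _ _ _ h h'.le le_rfl⟩))
    · exact (hdisj _ hv hv').elim
    · exact Or.inr (Or.inl ⟨hu, hw, lt_of_not_ge fun hle => hRC' _ h' (hC _ _ _ _ h le_rfl hle)⟩)
    · exact (hdisj _ hv hv').elim
  refine ⟨lt, { irrefl := hirr, trans := htrans }, ?_⟩
  have hmem : ∀ v, v ∈ X ∨ v ∈ Y := fun v => by
    rw [← Set.mem_union, hXY]; trivial
  have hcross : ∀ x ∈ X, ∀ y ∈ Y, (G.Adj x y ↔ ¬ lt x y ∧ ¬ lt y x) := by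
    intro x hx y hy
    have hx' : x ∉ Y := hdisj x hx
    have hy' : y ∉ X := fun h => hdisj y h hy
    rw [← not_iff_not, ← not_or, not_not]
    simp [lt, hx, hy, hx', hy', hzero ⟨x, hx⟩ ⟨y, hy⟩]
  ext u v
  change G.Adj u v ↔ u ≠ v ∧ ¬ lt u v ∧ ¬ lt v u
  have hsame : ∀ (hu : u ∈ X) (hv : v ∈ X), u ≠ v → lt u v ∨ lt v u := by
    intro hu hv huv
    rcases lt_trichotomy (r ⟨u, hu⟩) (r ⟨v, hv⟩) with h | h | h
    · exact Or.inl (Or.inl ⟨hu, hv, h⟩)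
    · exact (huv (congrArg Subtype.val (r.injective h))).elim
    · exact Or.inr (Or.inl ⟨hv, hu, h⟩)
  have hsame' : ∀ (hu : u ∈ Y) (hv : v ∈ Y), u ≠ v → lt u v ∨ lt v u := by
    intro hu hv huv
    rcases lt_trichotomy (s ⟨u, hu⟩) (s ⟨v, hv⟩) with h | h | h
    · exact Or.inl (Or.inr (Or.inl ⟨hu, hv, h⟩))
    · exact (huv (congrArg Subtype.val (s.injective h))).elim
    · exact Or.inr (Or.inr (Or.inl ⟨hv, hu, h⟩))
  constructor
  · intro h
    refine ⟨h.ne, ?_⟩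
    rcases hG.mem_of_adj h with ⟨hu, hv⟩ | ⟨hu, hv⟩
    · exact (hcross u hu v hv).1 h
    · exact ((hcross v hv u hu).1 h.symm).symm
  · rintro ⟨huv, h₁, h₂⟩
    rcases hmem u with hu | hu <;> rcases hmem v with hv | hv
    · exact ((hsame hu hv huv).elim h₁ h₂).elim
    · exact (hcross u hu v hv).2 ⟨h₁, h₂⟩
    · exact ((hcross v hv u hu).2 ⟨h₂, h₁⟩).symm
    · exact ((hsame' hu hv huv).elim h₁ h₂).elim

/-! ### Unit coordinates -/

/-- Real coordinates of the vertices of a bipartite graph such that two vertices of different parts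
are adjacent iff their coordinates differ by less than `1`. -/
structure UnitCoord (G : SimpleGraph V) (X Y : Set V) where
  coord : V → ℝ
  adj_iff : ∀ x ∈ X, ∀ y ∈ Y, G.Adj x y ↔ |coord x - coord y| < 1
  -- Excluding distance exactly `1` makes strict and weak comparisons interchangeable: closed unit
  -- intervals can be used, and shifts by `1` create no ties between the parts.
  ne_one : ∀ x ∈ X, ∀ y ∈ Y, |coord x - coord y| ≠ 1
  injOn_left : Set.InjOn coord X
  injOn_right : Set.InjOn coord Y

/-- Every nonempty set of vertices contains a maximal element any two neighbours of which have
another common neighbour. -/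
theorem exists_maximal_common_neighbor {G : SimpleGraph V} (lt : V → V → Prop)
    [IsStrictOrder V lt] (hG : G = incomparabilityGraph lt) (X : Set V)
    (hX : ∀ u v, G.Adj u v → (u ∈ X ↔ v ∉ X)) (S : Finset V) (hS : S.Nonempty) :
    ∃ v ∈ S, (∀ u ∈ S, ¬ lt v u) ∧ ∀ a ∈ S, ∀ b ∈ S, G.Adj v a → G.Adj v b → a ≠ b →
      ∃ w ∈ S, w ≠ v ∧ G.Adj w a ∧ G.Adj w b := by
  classical
  have hadj : ∀ u v, G.Adj u v ↔ u ≠ v ∧ ¬ lt u v ∧ ¬ lt v u := by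
    intro u v; rw [hG]; rfl
  let _ : PartialOrder V := partialOrderOfSO lt
  have hlt : ∀ u v : V, u < v ↔ lt u v := fun u v => Iff.rfl
  have hsame : ∀ u v, (u ∈ X ↔ v ∈ X) → u ≠ v → lt u v ∨ lt v u := by
    intro u v h huv
    by_contra hn
    push Not at hn
    have := hX u v ((hadj u v).2 ⟨huv, hn⟩)
    tauto
  obtain ⟨v, hv⟩ := Finset.exists_maximal hS
  have hvmax : ∀ u ∈ S, ¬ lt v u := fun u hu h => hv.not_gt hu h
  by_cases hdeg : ∃ a ∈ S, ∃ b ∈ S, G.Adj v a ∧ G.Adj v b ∧ a ≠ b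
  swap
  · refine ⟨v, hv.prop, hvmax, fun a ha b hb hva hvb hab => ?_⟩
    exact (hdeg ⟨a, ha, b, hb, hva, hvb, hab⟩).elim
  obtain ⟨a₀, ha₀, b₀, hb₀, hva₀, hvb₀, hab₀⟩ := hdeg
  -- When `v` has two neighbours in `S`, the vertex returned is not `v` but a maximal neighbour `m`
  -- of `v`. It is maximal in all of `S`, and every neighbour of it in `S` is also adjacent to any
  -- other neighbour `a` of `v` in `S`.
  obtain ⟨m, hm⟩ := Finset.exists_maximal (s := S.filter (G.Adj v)) ⟨a₀, by simp [ha₀, hva₀]⟩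
  have hmS : m ∈ S ∧ G.Adj v m := by simpa using hm.prop
  have hmmax : ∀ u ∈ S, ¬ lt m u := by
    intro u hu hmu
    by_cases hvu : G.Adj v u
    · exact hm.not_gt (by simp [hu, hvu]) hmu
    · have hvm := (hadj v m).1 hmS.2
      by_cases huv : v = u
      · subst huv; exact hvm.2.2 hmu
      · have : lt u v := by
          by_contra h
          exact hvu ((hadj v u).2 ⟨huv, hvmax u hu, h⟩)
        exact hvm.2.2 (_root_.trans hmu this)
  obtain ⟨a, ha, hva, ham⟩ : ∃ a ∈ S, G.Adj v a ∧ a ≠ m := by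
    by_cases h : a₀ = m
    · exact ⟨b₀, hb₀, hvb₀, fun h' => hab₀ (h.trans h'.symm)⟩
    · exact ⟨a₀, ha₀, hva₀, h⟩
  have ham' : lt a m := by
    have h1 := hX v a hva
    have h2 := hX v m hmS.2
    exact (hsame a m (by tauto) ham).resolve_right (hmmax a ha)
  have key : ∀ c ∈ S, G.Adj m c → G.Adj a c := by
    intro c hc hmc
    by_cases hcv : c = v
    · subst hcv; exact hva.symm
    have h1 := hX v m hmS.2
    have h2 := hX m c hmc
    have hcv' : lt c v := (hsame c v (by tauto) hcv).resolve_right (hvmax c hc)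
    have h3 := hX v a hva
    refine (hadj a c).2 ⟨?_, fun h => ?_, fun h => ?_⟩
    · rintro rfl; tauto
    · exact ((hadj v a).1 hva).2.2 (_root_.trans h hcv')
    · exact ((hadj m c).1 hmc).2.2 (_root_.trans h ham')
  exact ⟨m, hmS.1, hmmax, fun b hb c hc hmb hmc _ => ⟨a, ha, ham, key b hb hmb, key c hc hmc⟩⟩

/-- Induction removes a maximal vertex and then inserts its coordinate into a gap. The gap is
nonempty because two neighbours of that vertex have another common neighbour, which keeps their
coordinates less than `2` apart. -/
theorem exists_coord_of_cocomparability {G : SimpleGraph V} (lt : V → V → Prop)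
    [IsStrictOrder V lt] (hG : G = incomparabilityGraph lt) (X : Set V)
    (hX : ∀ u v, G.Adj u v → (u ∈ X ↔ v ∉ X)) (n : ℕ) : ∀ S : Finset V, S.card = n →
    ∃ f : V → ℝ, ∀ u ∈ S, ∀ v ∈ S, (lt u v → f u < f v) ∧
      (lt u v → (u ∈ X ↔ v ∉ X) → f u + 1 < f v) ∧ (G.Adj u v → f u < f v + 1) := by
  classical
  have hadj : ∀ u v, G.Adj u v ↔ u ≠ v ∧ ¬ lt u v ∧ ¬ lt v u := by
    intro u v; rw [hG]; rfl
  have hsame : ∀ u v, (u ∈ X ↔ v ∈ X) → u ≠ v → lt u v ∨ lt v u := by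
    intro u v h huv
    by_contra hn
    push Not at hn
    have := hX u v ((hadj u v).2 ⟨huv, hn⟩)
    tauto
  induction n with
  | zero =>
    intro S hS
    obtain rfl := Finset.card_eq_zero.1 hS
    exact ⟨0, by simp⟩
  | succ n ih =>
    intro S hS
    obtain ⟨v, hv, hvmax, hvcom⟩ := exists_maximal_common_neighbor lt hG X hX S
      (Finset.card_pos.1 (by omega))
    obtain ⟨f, hf⟩ := ih (S.erase v) (by rw [Finset.card_erase_of_mem hv]; omega)
    set T := S.erase v with hT
    have hTS : ∀ {u}, u ∈ T → u ∈ S := fun hu => Finset.mem_of_mem_erase hu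
    have hTv : ∀ {u}, u ∈ T → u ≠ v := fun hu => Finset.ne_of_mem_erase hu
    have hlt : ∀ u ∈ T, ¬ G.Adj v u → lt u v := by
      intro u hu h
      by_contra h'
      exact h ((hadj v u).2 ⟨(hTv hu).symm, hvmax u (hTS hu), h'⟩)
    -- The lower bound that `u` imposes on the coordinate of `v`: adjacency, a smaller vertex of the
    -- same part, and a smaller vertex of the other part, respectively. The only upper bounds come
    -- from neighbours, since `v` is maximal.
    let lo : V → ℝ := fun u =>
      if G.Adj v u then f u - 1 else if (u ∈ X ↔ v ∈ X) then f u else f u + 1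
    have hlohi : ∀ u ∈ T, ∀ w ∈ T, G.Adj v w → lo u < f w + 1 := by
      intro u hu w hw hvw
      have hXw := hX v w hvw
      have hvw' := (hadj v w).1 hvw
      by_cases hvu : G.Adj v u
      · simp only [lo, hvu, if_true]
        by_cases huw : u = w
        · subst huw; linarith
        · obtain ⟨z, hz, hzv, hzu, hzw⟩ := hvcom u (hTS hu) w (hTS hw) hvu hvw huw
          have hzT : z ∈ T := Finset.mem_erase.2 ⟨hzv, hz⟩
          have h1 := (hf u hu z hzT).2.2 hzu.symm
          have h2 := (hf z hzT w hw).2.2 hzw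
          linarith
      · have huv := hlt u hu hvu
        have hwu : ¬ lt w u := fun h => hvw'.2.2 (_root_.trans h huv)
        by_cases hc : u ∈ X ↔ v ∈ X
        · simp only [lo, hvu, hc, if_true, if_false]
          by_cases huw : lt u w
          · have := (hf u hu w hw).1 huw
            linarith
          · refine (hf u hu w hw).2.2 ((hadj u w).2 ⟨?_, huw, hwu⟩)
            rintro rfl
            exact hvu hvw
        · simp only [lo, hvu, hc, if_false]
          have hne : u ≠ w := by rintro rfl; exact hvu hvw
          have := (hf u hu w hw).1 ((hsame u w (by tauto) hne).resolve_right hwu)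
          linarith
    obtain ⟨t, ht₁, ht₂⟩ := Order.exists_between_finsets (T.image lo)
      ((T.filter (G.Adj v)).image fun w => f w + 1) (by
        simp only [Finset.mem_image, Finset.mem_filter]
        rintro _ ⟨u, hu, rfl⟩ _ ⟨w, ⟨hw, hvw⟩, rfl⟩
        exact hlohi u hu w hw hvw)
    have hlo : ∀ u ∈ T, lo u < t := fun u hu => ht₁ _ (Finset.mem_image_of_mem _ hu)
    have hhi : ∀ w ∈ T, G.Adj v w → t < f w + 1 := fun w hw hvw =>
      ht₂ _ (Finset.mem_image_of_mem (fun w => f w + 1) (Finset.mem_filter.2 ⟨hw, hvw⟩))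
    have hf' : ∀ u ∈ T, Function.update f v t u = f u := fun u hu => by simp [hTv hu]
    refine ⟨Function.update f v t, fun u hu w hw => ?_⟩
    by_cases hu' : u = v
    · subst hu'
      by_cases hw' : w = u
      · subst hw'
        exact ⟨fun h => (irrefl _ h).elim, fun h => (irrefl _ h).elim, fun h => (h.ne rfl).elim⟩
      · have hwT : w ∈ T := Finset.mem_erase.2 ⟨hw', hw⟩
        rw [hf' w hwT, Function.update_self]
        exact ⟨fun h => (hvmax w hw h).elim, fun h => (hvmax w hw h).elim, hhi w hwT⟩
    · have huT : u ∈ T := Finset.mem_erase.2 ⟨hu', hu⟩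
      by_cases hw' : w = v
      · subst hw'
        rw [hf' u huT, Function.update_self]
        have h := hlo u huT
        refine ⟨fun huw => ?_, fun huw hc => ?_, fun huw => ?_⟩
        · have hn : ¬ G.Adj w u := fun h => ((hadj w u).1 h).2.2 huw
          simp only [lo, hn, if_false] at h
          split_ifs at h <;> linarith
        · have hn : ¬ G.Adj w u := fun h => ((hadj w u).1 h).2.2 huw
          have hc' : ¬ (u ∈ X ↔ w ∈ X) := by tauto
          simpa only [lo, hn, hc', if_false] using h
        · simp only [lo, huw.symm, if_true] at h
          linarith
      · have hwT : w ∈ T := Finset.mem_erase.2 ⟨hw', hw⟩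
        rw [hf' u huT, hf' w hwT]
        exact hf u huT w hwT

theorem IsCocomparabilityGraph.nonempty_unitCoord [Finite V] {G : SimpleGraph V} {X Y : Set V}
    (hG : G.IsBipartiteWith X Y) (h : IsCocomparabilityGraph G) :
    Nonempty (UnitCoord G X Y) := by
  classical
  obtain ⟨lt, hlt, hGlt⟩ := h
  have := Fintype.ofFinite V
  have hdisj : ∀ v, v ∈ X → v ∉ Y := fun _ h => Set.disjoint_left.1 hG.disjoint h
  have hX : ∀ u v, G.Adj u v → (u ∈ X ↔ v ∉ X) := by
    intro u v h
    have := hdisj u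
    have := hdisj v
    have := hG.mem_of_adj h
    tauto
  have hY : ∀ u v, G.Adj u v → (u ∈ Y ↔ v ∉ Y) := by
    intro u v h
    have := hdisj u
    have := hdisj v
    have := hG.mem_of_adj h
    tauto
  obtain ⟨f, hf⟩ := exists_coord_of_cocomparability lt hGlt X hX _ Finset.univ rfl
  have hadj : ∀ u v, G.Adj u v ↔ u ≠ v ∧ ¬ lt u v ∧ ¬ lt v u := by
    intro u v; rw [hGlt]; rfl
  have hinj : ∀ u v, ¬ G.Adj u v → f u = f v → u = v := by
    intro u v h huv
    by_contra hne
    have h' : lt u v ∨ lt v u := by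
      by_contra hn
      push Not at hn
      exact h ((hadj u v).2 ⟨hne, hn⟩)
    rcases h' with h' | h'
    · exact ((hf u (by simp) v (by simp)).1 h').ne huv
    · exact ((hf v (by simp) u (by simp)).1 h').ne' huv
  have hcase : ∀ x ∈ X, ∀ y ∈ Y, (G.Adj x y → |f x - f y| < 1) ∧
      (¬ G.Adj x y → 1 < |f x - f y|) := by
    intro x hx y hy
    have hyX : y ∉ X := fun h => hdisj y h hy
    constructor
    · intro h
      have h1 := (hf x (by simp) y (by simp)).2.2 h
      have h2 := (hf y (by simp) x (by simp)).2.2 h.symm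
      rw [abs_lt]
      constructor <;> linarith
    · intro h
      have hne : x ≠ y := by rintro rfl; exact hyX hx
      have h' : lt x y ∨ lt y x := by
        by_contra hn
        push Not at hn
        exact h ((hadj x y).2 ⟨hne, hn⟩)
      rw [lt_abs]
      rcases h' with h' | h'
      · have := (hf x (by simp) y (by simp)).2.1 h' (by tauto)
        right; linarith
      · have := (hf y (by simp) x (by simp)).2.1 h' (by tauto)
        left; linarith
  refine ⟨⟨f, fun x hx y hy => ⟨(hcase x hx y hy).1, fun h => ?_⟩, fun x hx y hy h => ?_, ?_, ?_⟩⟩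
  · by_contra hn
    exact ((hcase x hx y hy).2 hn).not_gt h
  · by_cases hn : G.Adj x y
    · exact ((hcase x hx y hy).1 hn).ne h
    · exact ((hcase x hx y hy).2 hn).ne' h
  · exact fun u hu v hv h => hinj u v (fun ha => ((hX u v ha).1 hu) hv) h
  · exact fun u hu v hv h => hinj u v (fun ha => ((hY u v ha).1 hu) hv) h

/-! ### Interval representations -/

theorem UnitCoord.isUnitIntervalBigraph {G : SimpleGraph V} {X Y : Set V}
    (hG : G.IsBipartiteWith X Y) (hXY : X ∪ Y = Set.univ) (c : UnitCoord G X Y) :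
    IsUnitIntervalBigraph G := by
  classical
  have hdisj : ∀ v, v ∈ X → v ∉ Y := fun _ h => Set.disjoint_left.1 hG.disjoint h
  have hmem : ∀ v, v ∈ X ∨ v ∈ Y := fun v => by
    rw [← Set.mem_union, hXY]; trivial
  have hle : ∀ x ∈ X, ∀ y ∈ Y, (G.Adj x y ↔
      (Set.Icc (c.coord x) (c.coord x + 1) ∩ Set.Icc (c.coord y) (c.coord y + 1)).Nonempty) := by
    intro x hx y hy
    rw [c.adj_iff x hx y hy, Set.Icc_inter_Icc, Set.nonempty_Icc]
    simp only [le_inf_iff, sup_le_iff]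
    constructor
    · intro h
      rw [abs_lt] at h
      refine ⟨⟨?_, ?_⟩, ?_, ?_⟩ <;> linarith
    · rintro ⟨⟨-, h1⟩, h2, -⟩
      refine lt_of_le_of_ne (abs_le.2 ⟨?_, ?_⟩) (c.ne_one x hx y hy) <;> linarith
  refine ⟨⟨c.coord, fun v => c.coord v + 1, fun v => by linarith,
    fun v => if v ∈ X then 0 else 1, fun u v => ?_⟩, 1, fun v => by simp⟩
  rcases hmem u with hu | hu <;> rcases hmem v with hv | hv
  · have : ¬ G.Adj u v := fun h => by
      have := hG.mem_of_adj h
      have := hdisj u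
      have := hdisj v
      tauto
    simp [this, hu, hv]
  · have hv' : v ∉ X := fun h => hdisj v h hv
    simp [hu, hv', hle u hu v hv]
  · have hu' : u ∉ X := fun h => hdisj u h hu
    rw [G.adj_comm, Set.inter_comm]
    simp [hv, hu', hle v hv u hu]
  · have hu' : u ∉ X := fun h => hdisj u h hu
    have hv' : v ∉ X := fun h => hdisj v h hv
    have : ¬ G.Adj u v := fun h => by
      have := hG.mem_of_adj h
      tauto
    simp [this, hu', hv']

theorem IsUnitIntervalBigraph.isProperIntervalBigraph {G : SimpleGraph V}
    (h : IsUnitIntervalBigraph G) : IsProperIntervalBigraph G := by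
  obtain ⟨ρ, len, hlen⟩ := h
  refine ⟨ρ, fun u v huv => huv.2 ?_⟩
  have h := (Set.Icc_subset_Icc_iff (ρ.left_le_right u)).1 huv.1
  have := hlen u
  have := hlen v
  exact Set.Icc_subset_Icc (by linarith) (by linarith)

theorem IsProperIntervalBigraph.isClassProperIntervalGraph {G : SimpleGraph V}
    (h : IsProperIntervalBigraph G) : IsClassProperIntervalGraph G 2 := by
  obtain ⟨ρ, hρ⟩ := h
  exact ⟨ρ, fun u v _ => hρ u v⟩

theorem IntervalRep.right_le_right {G : SimpleGraph V} {k : ℕ} (ρ : IntervalRep G k) {u v : V}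
    (hv : ¬ ρ.interval v ⊂ ρ.interval u)
    (h : ρ.left u ≤ ρ.left v) : ρ.right u ≤ ρ.right v := by
  by_contra! hlt
  have hsub : ρ.interval v ⊆ ρ.interval u := Set.Icc_subset_Icc h hlt.le
  have : ρ.right u ∈ ρ.interval v := by
    by_contra hn
    exact hv ⟨hsub, fun h' => hn (h' ⟨ρ.left_le_right u, le_rfl⟩)⟩
  exact hlt.not_ge this.2

/-- Within a class, sorting by left endpoints also sorts the right endpoints, which gives the
exchange property. The bipartition is that of the classes, which need not be `X` and `Y`; this is
harmless because the conclusion mentions no parts. -/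
theorem IsClassProperIntervalGraph.isCocomparabilityGraph [Finite V] {G : SimpleGraph V}
    (h : IsClassProperIntervalGraph G 2) : IsCocomparabilityGraph G := by
  obtain ⟨ρ, hρ⟩ := h
  have hcls : ∀ v, ρ.cls v = 0 ∨ ρ.cls v = 1 := fun v => by
    generalize ρ.cls v = i
    fin_cases i <;> simp
  have hG : G.IsBipartiteWith {v | ρ.cls v = 0} {v | ρ.cls v = 1} := by
    refine ⟨Set.disjoint_left.2 fun v hv hv' => ?_, fun u v huv => ?_⟩
    · exact absurd (hv.symm.trans hv') (by decide)
    · have := ((ρ.adj_iff u v).1 huv).1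
      rcases hcls u with hu | hu <;> rcases hcls v with hv | hv
      · exact (this (hu.trans hv.symm)).elim
      · exact Or.inl ⟨hu, hv⟩
      · exact Or.inr ⟨hu, hv⟩
      · exact (this (hu.trans hv.symm)).elim
  have hXY : {v | ρ.cls v = 0} ∪ {v | ρ.cls v = 1} = Set.univ := Set.eq_univ_of_forall hcls
  refine HasMonotoneConsecutiveArrangement.isCocomparabilityGraph hG hXY
    (HasStrongOrdering.hasMonotoneConsecutiveArrangement
      (hasStrongOrdering_of_key ρ.left ?_))
  intro x hx x' hx' y hy y' hy' hxy hxy' hxx hyy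
  have hmeet : ∀ u ∈ {v | ρ.cls v = 0}, ∀ v ∈ {v | ρ.cls v = 1}, (G.Adj u v ↔
      ρ.left u ≤ ρ.right v ∧ ρ.left v ≤ ρ.right u) := by
    intro u hu v hv
    have hne : ρ.cls u ≠ ρ.cls v := by
      rw [show ρ.cls u = 0 from hu, show ρ.cls v = 1 from hv]; decide
    rw [ρ.adj_iff, Set.Icc_inter_Icc, Set.nonempty_Icc]
    simp only [le_inf_iff, sup_le_iff]
    have := ρ.left_le_right u
    have := ρ.left_le_right v
    tauto
  have hcx : ρ.cls x = ρ.cls x' := Eq.trans hx (Eq.symm hx')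
  have hcy : ρ.cls y = ρ.cls y' := Eq.trans hy (Eq.symm hy')
  have hx'' := ρ.right_le_right (hρ _ _ hcx.symm) hxx
  have hy'' := ρ.right_le_right (hρ _ _ hcy) hyy
  rw [hmeet x hx y hy] at hxy
  rw [hmeet x' hx' y' hy'] at hxy'
  rw [hmeet x hx y' hy', hmeet x' hx' y hy]
  refine ⟨⟨?_, ?_⟩, ?_, ?_⟩ <;> linarith

/-! ### Permutation graphs -/

/-- At height `t` the abscissas differ by an affine function of `t`, which vanishes on `[0, 1]`
unless its end values have the same strict sign. -/
theorem segment_inter_segment_nonempty_iff (a b c d : ℝ) :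
    (segment ℝ ((a, 0) : ℝ × ℝ) (b, 1) ∩ segment ℝ ((c, 0) : ℝ × ℝ) (d, 1)).Nonempty ↔
      ¬ (a < c ∧ b < d) ∧ ¬ (c < a ∧ d < b) := by
  have hmem : ∀ a b : ℝ, ∀ p : ℝ × ℝ, p ∈ segment ℝ ((a, 0) : ℝ × ℝ) (b, 1) ↔
      0 ≤ p.2 ∧ p.2 ≤ 1 ∧ p.1 = (1 - p.2) * a + p.2 * b := by
    rintro a b ⟨x, t⟩
    rw [segment_eq_image]
    simp only [Set.mem_image, Set.mem_Icc, Prod.smul_mk, Prod.mk_add_mk, smul_eq_mul, mul_zero,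
      mul_one, zero_add, Prod.mk.injEq]
    constructor
    · rintro ⟨θ, ⟨h0, h1⟩, hx, rfl⟩
      exact ⟨h0, h1, hx.symm⟩
    · rintro ⟨h0, h1, hx⟩
      exact ⟨t, ⟨h0, h1⟩, hx.symm, rfl⟩
  constructor
  · rintro ⟨⟨x, t⟩, h1, h2⟩
    rw [hmem] at h1 h2
    obtain ⟨h0, h1, hx⟩ := h1
    obtain ⟨-, -, hx'⟩ := h2
    dsimp only at *
    constructor
    · rintro ⟨hac, hbd⟩
      rcases h0.eq_or_lt with rfl | h0
      · linarith
      · nlinarith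
    · rintro ⟨hac, hbd⟩
      rcases h0.eq_or_lt with rfl | h0
      · linarith
      · nlinarith
  · intro h
    have h' : (a - c) * (b - d) ≤ 0 := by
      by_contra! hpos
      rcases pos_and_pos_or_neg_and_neg_of_mul_pos hpos with ⟨h1, h2⟩ | ⟨h1, h2⟩
      · exact h.2 ⟨by linarith, by linarith⟩
      · exact h.1 ⟨by linarith, by linarith⟩
    obtain ⟨t, h0, h1, ht⟩ : ∃ t : ℝ, 0 ≤ t ∧ t ≤ 1 ∧ (1 - t) * (a - c) + t * (b - d) = 0 := by
      have hcont : ContinuousOn (fun t : ℝ => (1 - t) * (a - c) + t * (b - d)) (Set.uIcc 0 1) := by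
        fun_prop
      have hz : (0 : ℝ) ∈ Set.uIcc ((1 - (0 : ℝ)) * (a - c) + 0 * (b - d))
          ((1 - (1 : ℝ)) * (a - c) + 1 * (b - d)) := by
        rw [Set.mem_uIcc]
        rcases mul_nonpos_iff.1 h' with ⟨h1, h2⟩ | ⟨h1, h2⟩
        · right; constructor <;> linarith
        · left; constructor <;> linarith
      obtain ⟨t, ht, htz⟩ := intermediate_value_uIcc hcont hz
      rw [Set.uIcc_of_le zero_le_one] at ht
      exact ⟨t, ht.1, ht.2, htz⟩
    refine ⟨((1 - t) * a + t * b, t), (hmem _ _ _).2 ⟨h0, h1, rfl⟩, (hmem _ _ _).2 ⟨h0, h1, ?_⟩⟩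
    dsimp only
    linarith

theorem isPermutationGraph_iff (G : SimpleGraph V) :
    IsPermutationGraph G ↔ ∃ p q : V → ℝ, ∀ u v, G.Adj u v ↔
      u ≠ v ∧ ¬ (p u < p v ∧ q u < q v) ∧ ¬ (p v < p u ∧ q v < q u) := by
  simp only [IsPermutationGraph, segment_inter_segment_nonempty_iff]

theorem IsPermutationGraph.isCocomparabilityGraph {G : SimpleGraph V}
    (h : IsPermutationGraph G) : IsCocomparabilityGraph G := by
  obtain ⟨p, q, h⟩ := (isPermutationGraph_iff G).1 h
  refine ⟨fun u v => p u < p v ∧ q u < q v, { irrefl := ?_, trans := ?_ }, ?_⟩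
  · exact fun u h => lt_irrefl _ h.1
  · exact fun u v w h h' => ⟨h.1.trans h'.1, h.2.trans h'.2⟩
  · ext u v
    exact h u v

/-- The abscissas on the two channels of the segments of a permutation representation in which no
two segments share an endpoint. -/
theorem UnitCoord.exists_injective {G : SimpleGraph V} {X Y : Set V}
    (hG : G.IsBipartiteWith X Y) (hXY : X ∪ Y = Set.univ) (c : UnitCoord G X Y) :
    ∃ p q : V → ℝ, Function.Injective p ∧ Function.Injective q ∧
      (∀ u v, G.Adj u v ↔ u ≠ v ∧ ¬ (p u < p v ∧ q u < q v) ∧ ¬ (p v < p u ∧ q v < q u)) ∧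
      ∀ u v w, q u < q v → q v < q w → G.Adj u w →
        (InDifferentParts X Y v u → G.Adj v u) ∧ (InDifferentParts X Y v w → G.Adj v w) := by
  classical
  have hdisj : ∀ v, v ∈ X → v ∉ Y := fun _ h => Set.disjoint_left.1 hG.disjoint h
  have hdisj' : ∀ v, v ∈ Y → v ∉ X := fun v h h' => hdisj v h' h
  have hmem : ∀ v, v ∈ X ∨ v ∈ Y := fun v => by
    rw [← Set.mem_union, hXY]; trivial
  -- Shifting `X` by `+1` on one channel and by `-1` on the other reverses the order of `x` and `y`
  -- exactly when their coordinates differ by less than `1`. Vertices of the same part keep their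
  -- order.
  let p : V → ℝ := fun v => if v ∈ X then c.coord v + 1 else c.coord v
  let q : V → ℝ := fun v => if v ∈ X then c.coord v - 1 else c.coord v
  have hpX : ∀ v ∈ X, p v = c.coord v + 1 := fun v hv => by simp [p, hv]
  have hpY : ∀ v ∈ Y, p v = c.coord v := fun v hv => by simp [p, hdisj' v hv]
  have hqX : ∀ v ∈ X, q v = c.coord v - 1 := fun v hv => by simp [q, hv]
  have hqY : ∀ v ∈ Y, q v = c.coord v := fun v hv => by simp [q, hdisj' v hv]
  have hne : ∀ x ∈ X, ∀ y ∈ Y, c.coord x - c.coord y ≠ 1 ∧ c.coord x - c.coord y ≠ -1 := by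
    intro x hx y hy
    have := c.ne_one x hx y hy
    exact ⟨fun h => this (by simp [h]), fun h => this (by simp [h])⟩
  have hcross : ∀ x ∈ X, ∀ y ∈ Y, (G.Adj x y ↔
      c.coord x - c.coord y < 1 ∧ -1 < c.coord x - c.coord y) := by
    intro x hx y hy
    rw [c.adj_iff x hx y hy, abs_lt, and_comm]
  have hXX : ∀ u ∈ X, ∀ v ∈ X, ¬ G.Adj u v := fun u hu v hv h => by
    have := hG.mem_of_adj h
    have := hdisj u hu
    have := hdisj v hv
    tauto
  have hYY : ∀ u ∈ Y, ∀ v ∈ Y, ¬ G.Adj u v := fun u hu v hv h => by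
    have := hG.mem_of_adj h
    have := hdisj' u hu
    have := hdisj' v hv
    tauto
  have hsame : ∀ u v, u ≠ v → p u = c.coord u + (p v - c.coord v) →
      q u = c.coord u + (q v - c.coord v) → c.coord u ≠ c.coord v →
      (p u < p v ∧ q u < q v) ∨ (p v < p u ∧ q v < q u) := by
    intro u v _ h1 h2 hne
    rcases lt_or_gt_of_ne hne with h | h
    · left; constructor <;> linarith
    · right; constructor <;> linarith
  have hadj : ∀ x ∈ X, ∀ y ∈ Y, (G.Adj x y ↔
      x ≠ y ∧ ¬ (p x < p y ∧ q x < q y) ∧ ¬ (p y < p x ∧ q y < q x)) := by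
    intro x hx y hy
    have hxy : x ≠ y := by rintro rfl; exact hdisj x hx hy
    rw [hcross x hx y hy, hpX x hx, hpY y hy, hqX x hx, hqY y hy]
    obtain ⟨h1, h2⟩ := hne x hx y hy
    constructor
    · rintro ⟨h3, h4⟩
      refine ⟨hxy, fun h => ?_, fun h => ?_⟩ <;> linarith [h.1, h.2]
    · rintro ⟨-, h3, h4⟩
      constructor
      · by_contra! h
        have := lt_of_le_of_ne h h1.symm
        exact h4 ⟨by linarith, by linarith⟩
      · by_contra! h
        have := lt_of_le_of_ne h h2
        exact h3 ⟨by linarith, by linarith⟩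
  refine ⟨p, q, fun u v h => ?_, fun u v h => ?_, fun u v => ?_, fun u v w huv hvw huw => ?_⟩
  · rcases hmem u with hu | hu <;> rcases hmem v with hv | hv
    · rw [hpX u hu, hpX v hv] at h
      exact c.injOn_left hu hv (by linarith)
    · rw [hpX u hu, hpY v hv] at h
      exact ((hne u hu v hv).2 (by linarith)).elim
    · rw [hpY u hu, hpX v hv] at h
      exact ((hne v hv u hu).2 (by linarith)).elim
    · rw [hpY u hu, hpY v hv] at h
      exact c.injOn_right hu hv h
  · rcases hmem u with hu | hu <;> rcases hmem v with hv | hv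
    · rw [hqX u hu, hqX v hv] at h
      exact c.injOn_left hu hv (by linarith)
    · rw [hqX u hu, hqY v hv] at h
      exact ((hne u hu v hv).1 (by linarith)).elim
    · rw [hqY u hu, hqX v hv] at h
      exact ((hne v hv u hu).1 (by linarith)).elim
    · rw [hqY u hu, hqY v hv] at h
      exact c.injOn_right hu hv h
  · rcases hmem u with hu | hu <;> rcases hmem v with hv | hv
    · refine ⟨fun h => (hXX u hu v hv h).elim, fun ⟨huv, h1, h2⟩ => ?_⟩
      refine ((hsame u v huv ?_ ?_ fun h => huv (c.injOn_left hu hv h)).elim h1 h2).elim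
      · rw [hpX u hu, hpX v hv]; ring
      · rw [hqX u hu, hqX v hv]; ring
    · exact hadj u hu v hv
    · rw [G.adj_comm, hadj v hv u hu, ne_comm, and_comm (a := ¬ (p u < p v ∧ q u < q v))]
    · refine ⟨fun h => (hYY u hu v hv h).elim, fun ⟨huv, h1, h2⟩ => ?_⟩
      refine ((hsame u v huv ?_ ?_ fun h => huv (c.injOn_right hu hv h)).elim h1 h2).elim
      · rw [hpY u hu, hpY v hv]; ring
      · rw [hqY u hu, hqY v hv]; ring
  · rcases hG.mem_of_adj huw with ⟨hu, hw⟩ | ⟨hu, hw⟩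
    · have hu' := hdisj u hu
      have hw' := hdisj' w hw
      have huw' := (hcross u hu w hw).1 huw
      rw [hqX u hu] at huv
      rw [hqY w hw] at hvw
      constructor
      · rintro (⟨-, h⟩ | ⟨hv, -⟩)
        · exact (hu' h).elim
        · rw [hqY v hv] at huv hvw
          refine ((hcross u hu v hv).2 ⟨?_, ?_⟩).symm <;> linarith
      · rintro (⟨hv, -⟩ | ⟨-, h⟩)
        · rw [hqX v hv] at huv hvw
          refine (hcross v hv w hw).2 ⟨?_, ?_⟩ <;> linarith
        · exact (hw' h).elim
    -- In the order by `q`, the end of an edge in `X` always precedes its end in `Y`, so this case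
    -- is void.
    · have := (hcross w hw u hu).1 huw.symm
      rw [hqY u hu] at huv
      rw [hqX w hw] at hvw
      linarith

theorem UnitCoord.isPermutationGraph {G : SimpleGraph V} {X Y : Set V}
    (hG : G.IsBipartiteWith X Y) (hXY : X ∪ Y = Set.univ) (c : UnitCoord G X Y) :
    IsPermutationGraph G := by
  obtain ⟨p, q, -, -, h, -⟩ := c.exists_injective hG hXY
  exact (isPermutationGraph_iff G).2 ⟨p, q, h⟩

/-! ### Umbrella orderings -/

theorem UnitCoord.hasUmbrellaOrdering [Finite V] {G : SimpleGraph V} {X Y : Set V}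
    (hG : G.IsBipartiteWith X Y) (hXY : X ∪ Y = Set.univ) (c : UnitCoord G X Y) :
    HasUmbrellaOrdering G X Y := by
  obtain ⟨p, q, -, hq, -, h⟩ := c.exists_injective hG hXY
  obtain ⟨pos, hpos⟩ := exists_equiv_fin_of_key q
  have hpos' : ∀ u v, pos u < pos v → q u < q v := fun u v huv =>
    lt_of_le_of_ne (hpos u v huv) fun he => huv.ne (congrArg pos (hq he))
  exact ⟨pos, fun u v w huv hvw => h u v w (hpos' u v huv) (hpos' v w hvw)⟩

theorem HasUmbrellaOrdering.hasStrongOrdering [Finite V] {G : SimpleGraph V} {X Y : Set V}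
    (hG : G.IsBipartiteWith X Y) (h : HasUmbrellaOrdering G X Y) : HasStrongOrdering G X Y := by
  obtain ⟨pos, h⟩ := h
  refine hasStrongOrdering_of_key pos fun x hx x' hx' y hy y' hy' hxy hxy' hxx hyy => ?_
  have hne : ∀ u ∈ X, ∀ v ∈ Y, pos u < pos v ∨ pos v < pos u := by
    intro u hu v hv
    refine lt_or_gt_of_ne fun he => ?_
    obtain rfl := pos.injective he
    exact Set.disjoint_left.1 hG.disjoint hu hv
  rcases hxx.eq_or_lt with he | hxx
  · obtain rfl := pos.injective he
    exact ⟨hxy', hxy⟩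
  rcases hyy.eq_or_lt with he | hyy
  · obtain rfl := pos.injective he
    exact ⟨hxy, hxy'⟩
  have hYX : ∀ u ∈ Y, ∀ v ∈ X, InDifferentParts X Y u v := fun u hu v hv => Or.inr ⟨hu, hv⟩
  have hXY : ∀ u ∈ X, ∀ v ∈ Y, InDifferentParts X Y u v := fun u hu v hv => Or.inl ⟨hu, hv⟩
  constructor
  -- Either `y'` lies between the ends of the edge `x y`, or `x` lies between the ends of `y' x'`.
  -- The second half is similar.
  · rcases hne x hx y' hy' with h' | h'
    · exact ((h x y' y h' hyy hxy).1 (hYX y' hy' x hx)).symm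
    · exact (h y' x x' h' hxx hxy'.symm).1 (hXY x hx y' hy')
  · rcases hne x' hx' y hy with h' | h'
    · exact (h x x' y hxx h' hxy).2 (hXY x' hx' y hy)
    · exact ((h y' y x' hyy h' hxy'.symm).2 (hYX y hy x' hx')).symm

/-! ### Posets of dimension at most two -/

theorem isStrictTotalOrder_of_injective {p : V → ℝ} (hp : Function.Injective p) :
    IsStrictTotalOrder V fun u v => p u < p v where
  trichotomous _ _ h h' := hp (le_antisymm (not_lt.1 h') (not_lt.1 h))
  irrefl u := lt_irrefl (p u)
  trans _ _ _ := lt_trans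

theorem orderDim_le_two {lt L₁ L₂ : V → V → Prop} (h₁ : IsStrictTotalOrder V L₁)
    (h₂ : IsStrictTotalOrder V L₂) (h : ∀ u v, lt u v ↔ L₁ u v ∧ L₂ u v) : orderDim lt ≤ 2 := by
  refine iInf₂_le (α := ℕ∞) 2 ⟨![L₁, L₂], fun i => ?_, fun u v => ?_⟩
  · fin_cases i
    · exact h₁
    · exact h₂
  · rw [h, Fin.forall_fin_two]
    rfl

theorem exists_isRealizer_of_orderDim_le_two {lt : V → V → Prop} (h : orderDim lt ≤ 2) :
    ∃ d ≤ 2, ∃ L : Fin d → V → V → Prop, IsRealizer lt L := by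
  have h3 : orderDim lt < 3 := lt_of_le_of_lt h (by norm_num)
  simp only [orderDim, iInf_lt_iff] at h3
  obtain ⟨d, hd, hlt⟩ := h3
  have : d < 3 := by exact_mod_cast hlt
  exact ⟨d, by omega, hd⟩

theorem UnitCoord.isIncomparabilityGraphOfDimLE {G : SimpleGraph V} {X Y : Set V}
    (hG : G.IsBipartiteWith X Y) (hXY : X ∪ Y = Set.univ) (c : UnitCoord G X Y) :
    IsIncomparabilityGraphOfDimLE G 2 := by
  obtain ⟨p, q, hp, hq, h, -⟩ := c.exists_injective hG hXY
  refine ⟨fun u v => p u < p v ∧ q u < q v, { irrefl := ?_, trans := ?_ }, ?_, ?_⟩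
  · exact fun u h => lt_irrefl _ h.1
  · exact fun u v w h h' => ⟨h.1.trans h'.1, h.2.trans h'.2⟩
  · exact orderDim_le_two (isStrictTotalOrder_of_injective hp)
      (isStrictTotalOrder_of_injective hq) fun u v => Iff.rfl
  · ext u v
    exact h u v

theorem UnitCoord.isComparabilityGraphOfDimLE {G : SimpleGraph V} {X Y : Set V}
    (hG : G.IsBipartiteWith X Y) (hXY : X ∪ Y = Set.univ) (c : UnitCoord G X Y) :
    IsComparabilityGraphOfDimLE G 2 := by
  obtain ⟨p, q, hp, hq, h, -⟩ := c.exists_injective hG hXY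
  refine ⟨fun u v => p u < p v ∧ -q u < -q v, { irrefl := ?_, trans := ?_ }, ?_, ?_⟩
  · exact fun u h => lt_irrefl _ h.1
  · exact fun u v w h h' => ⟨h.1.trans h'.1, h.2.trans h'.2⟩
  · exact orderDim_le_two (isStrictTotalOrder_of_injective hp)
      (isStrictTotalOrder_of_injective (neg_injective.comp hq)) fun u v => Iff.rfl
  · ext u v
    rw [h]
    simp only [comparabilityGraph, neg_lt_neg_iff]
    refine and_congr_right fun huv => ?_
    rcases lt_or_gt_of_ne (hp.ne huv) with h1 | h1 <;>
      rcases lt_or_gt_of_ne (hq.ne huv) with h2 | h2 <;>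
      simp [h1, h2, h1.le, h2.le]

theorem IsIncomparabilityGraphOfDimLE.isCocomparabilityGraph {G : SimpleGraph V} {d : ℕ}
    (h : IsIncomparabilityGraphOfDimLE G d) : IsCocomparabilityGraph G := by
  obtain ⟨lt, hlt, -, h⟩ := h
  exact ⟨lt, hlt, h⟩

/-- Reversing one of two linear orders exchanges the pairs on which they agree with those on which
they disagree, hence comparability with incomparability. -/
theorem IsComparabilityGraphOfDimLE.isCocomparabilityGraph {G : SimpleGraph V}
    (h : IsComparabilityGraphOfDimLE G 2) : IsCocomparabilityGraph G := by
  obtain ⟨lt, hlt, hd, rfl⟩ := h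
  obtain ⟨L₁, L₂, h₁, h₂, h⟩ : ∃ L₁ L₂ : V → V → Prop, IsStrictTotalOrder V L₁ ∧
      IsStrictTotalOrder V L₂ ∧ ∀ u v, u ≠ v → (lt u v ↔ L₁ u v ∧ L₂ u v) := by
    obtain ⟨d, hd, L, hL, hLlt⟩ := exists_isRealizer_of_orderDim_le_two hd
    interval_cases d
    -- An empty intersection of orders is the full relation, so irreflexivity leaves no vertices.
    · have hsub : ∀ u v : V, u = v := fun u _ => (irrefl_of lt u ((hLlt u u).2 (by simp))).elim
      let _ : LinearOrder V := IsWellOrder.linearOrder (WellOrderingRel : V → V → Prop)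
      exact ⟨(· < ·), (· < ·), inferInstance, inferInstance, fun u v huv => (huv (hsub u v)).elim⟩
    · exact ⟨L 0, L 0, hL 0, hL 0, fun u v _ => by simp [hLlt]⟩
    · exact ⟨L 0, L 1, hL 0, hL 1, fun u v _ => by rw [hLlt, Fin.forall_fin_two]⟩
  refine ⟨fun u v => L₁ u v ∧ L₂ v u, { irrefl := ?_, trans := ?_ }, ?_⟩
  · exact fun u h => irrefl_of L₁ u h.1
  · exact fun u v w h h' => ⟨trans_of L₁ h.1 h'.1, trans_of L₂ h'.2 h.2⟩
  · ext u v
    simp only [comparabilityGraph, incomparabilityGraph]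
    refine and_congr_right fun huv => ?_
    rw [h u v huv, h v u huv.symm]
    have := trichotomous_of L₁ u v
    have := trichotomous_of L₂ u v
    have := asymm_of L₁ (a := u) (b := v)
    have := asymm_of L₂ (a := u) (b := v)
    tauto

/-! ### Paths avoiding a neighbourhood -/

theorem PathAvoiding.of_walk {G : SimpleGraph V} {u v w : V} (P : G.Walk u v)
    (h : ∀ z ∈ P.support, ¬ G.Adj w z) : PathAvoiding G u v w := by
  classical
  exact ⟨P.bypass, P.bypass_isPath, fun z hz => h z (P.support_bypass_subset_support hz)⟩

theorem PathAvoiding.refl {G : SimpleGraph V} {u w : V} (h : ¬ G.Adj w u) :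
    PathAvoiding G u u w :=
  .of_walk .nil (by simpa using h)

theorem PathAvoiding.symm {G : SimpleGraph V} {u v w : V} (h : PathAvoiding G u v w) :
    PathAvoiding G v u w := by
  obtain ⟨P, -, hP⟩ := h
  exact .of_walk P.reverse (by simpa using hP)

theorem PathAvoiding.trans {G : SimpleGraph V} {u v v' w : V} (h : PathAvoiding G u v w)
    (h' : PathAvoiding G v v' w) : PathAvoiding G u v' w := by
  obtain ⟨P, -, hP⟩ := h
  obtain ⟨Q, -, hQ⟩ := h'
  refine .of_walk (P.append Q) fun z hz => ?_
  rw [SimpleGraph.Walk.mem_support_append_iff] at hz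
  exact hz.elim (hP z) (hQ z)

theorem PathAvoiding.cons {G : SimpleGraph V} {u u' v w : V} (hw : ¬ G.Adj w u) (h : G.Adj u u')
    (h' : PathAvoiding G u' v w) : PathAvoiding G u v w := by
  obtain ⟨P, -, hP⟩ := h'
  exact .of_walk (P.cons h) (by simpa using ⟨hw, hP⟩)

theorem PathAvoiding.not_adj_left {G : SimpleGraph V} {u v w : V} (h : PathAvoiding G u v w) :
    ¬ G.Adj w u := by
  obtain ⟨P, -, hP⟩ := h
  exact hP u P.start_mem_support

theorem PathAvoiding.not_adj_right {G : SimpleGraph V} {u v w : V} (h : PathAvoiding G u v w) :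
    ¬ G.Adj w v := h.symm.not_adj_left

theorem PathAvoiding.reachable {G : SimpleGraph V} {u v w : V} (h : PathAvoiding G u v w) :
    G.Reachable u v := by
  obtain ⟨P, -, -⟩ := h
  exact ⟨P⟩

/-- A relation that is preserved along the edges outside the neighbourhood of `w` is preserved
along the paths avoiding it. -/
theorem PathAvoiding.induction {G : SimpleGraph V} {u v w : V} (h : PathAvoiding G u v w)
    (p : V → Prop) (hp : ∀ z z', G.Adj z z' → ¬ G.Adj w z → ¬ G.Adj w z' → p z → p z')
    (hu : p u) : p v := by
  obtain ⟨P, -, hP⟩ := h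
  induction P with
  | nil => exact hu
  | cons hadj P ih =>
    simp only [SimpleGraph.Walk.support_cons, List.mem_cons, forall_eq_or_imp] at hP
    exact ih (hp _ _ hadj hP.1 (hP.2 _ P.start_mem_support) hu) hP.2

theorem PathAvoiding.exists_adj {G : SimpleGraph V} {u v w : V} (h : PathAvoiding G u v w)
    (huv : u ≠ v) : ∃ z, G.Adj u z ∧ ¬ G.Adj w z := by
  obtain ⟨P, -, hP⟩ := h
  cases P with
  | nil => exact (huv rfl).elim
  | cons hadj P =>
    simp only [SimpleGraph.Walk.support_cons, List.mem_cons, forall_eq_or_imp] at hP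
    exact ⟨_, hadj, hP.2 _ P.start_mem_support⟩

/-! ### Cocomparability graphs have no asteroidal triple -/

theorem IsAsteroidalTriple.rotate {G : SimpleGraph V} {u v w : V} (h : IsAsteroidalTriple G u v w) :
    IsAsteroidalTriple G v w u :=
  ⟨h.2.1, h.2.2.1.symm, h.1.symm, h.2.2.2.2.1, h.2.2.2.2.2, h.2.2.2.1⟩

theorem IsAsteroidalTriple.swap {G : SimpleGraph V} {u v w : V} (h : IsAsteroidalTriple G u v w) :
    IsAsteroidalTriple G v u w :=
  ⟨h.1.symm, h.2.2.1, h.2.1, h.2.2.2.1.symm, h.2.2.2.2.2.symm, h.2.2.2.2.1.symm⟩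

/-- The three vertices would form a chain. A path avoiding the neighbourhood of the middle one
cannot pass from below it to above it, since adjacent vertices are incomparable. -/
theorem IsCocomparabilityGraph.not_exists_isAsteroidalTriple {G : SimpleGraph V}
    (h : IsCocomparabilityGraph G) : ¬ ∃ u v w, IsAsteroidalTriple G u v w := by
  obtain ⟨lt, hlt, hG⟩ := h
  have hadj : ∀ u v, G.Adj u v ↔ u ≠ v ∧ ¬ lt u v ∧ ¬ lt v u := by
    intro u v; rw [hG]; rfl
  have hcomp : ∀ u v, u ≠ v → ¬ G.Adj u v → lt u v ∨ lt v u := by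
    intro u v huv h
    by_contra hn
    push Not at hn
    exact h ((hadj u v).2 ⟨huv, hn⟩)
  have hmid : ∀ u v w, IsAsteroidalTriple G u v w → lt u v → ¬ lt v w := by
    rintro u v w ⟨-, -, -, -, -, h⟩ huv hvw
    have := h.symm.induction (fun z => lt z v) (fun z z' hzz hz hz' hzv => ?_) huv
    · exact asymm_of lt this hvw
    · have hne : z' ≠ v := by rintro rfl; exact hz hzz.symm
      exact (hcomp z' v hne fun h => hz' h.symm).resolve_right fun h =>
        ((hadj z z').1 hzz).2.1 (trans_of lt hzv h)
  rintro ⟨u, v, w, h⟩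
  have huv := hcomp u v h.1 h.2.2.2.2.1.not_adj_left
  have hvw := hcomp v w h.2.1 h.2.2.2.2.2.not_adj_left
  have huw := hcomp u w h.2.2.1 h.2.2.2.2.1.not_adj_right
  have h₁ := hmid _ _ _ h
  have h₂ := hmid _ _ _ h.rotate
  have h₃ := hmid _ _ _ h.rotate.rotate
  have h₄ := hmid _ _ _ h.swap
  have h₅ := hmid _ _ _ h.rotate.swap
  have h₆ := hmid _ _ _ h.rotate.rotate.swap
  tauto

/-! ### Extremal vertices of graphs without asteroidal triples -/

/-- `y` and `z` are unrelated with respect to `s`: each of them is joined to `s` by a path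
containing no neighbour of the other. -/
def Unrelated (G : SimpleGraph V) (s y z : V) : Prop :=
  y ≠ z ∧ y ≠ s ∧ z ≠ s ∧ PathAvoiding G y s z ∧ PathAvoiding G z s y

/-- The set of vertices that can be reached from `v` along paths containing no neighbour of `s`. -/
def avoidingComponent (G : SimpleGraph V) (s v : V) : Set V :=
  {t | PathAvoiding G v t s}

/-- The base exceeds the number of terms, so one exponent above `m` outweighs all terms with
exponent at most `m`. The sum thus rewards large components first, as a lexicographic comparison
would. -/
theorem sum_pow_lt_sum_pow {α : Type*} [Fintype α] (a b : α → ℕ) (m : ℕ)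
    (hab : ∀ v, m < a v → a v ≤ b v) (y : α) (hy : a y ≤ m) (hy' : m < b y) :
    ∑ v, (Fintype.card α + 1) ^ a v < ∑ v, (Fintype.card α + 1) ^ b v := by
  classical
  set N := Fintype.card α + 1 with hN
  have hN0 : 0 < N := Nat.succ_pos _
  rw [← Finset.sum_filter_add_sum_filter_not _ (fun v => m < a v) fun v => N ^ a v,
    ← Finset.sum_filter_add_sum_filter_not _ (fun v => m < a v) fun v => N ^ b v]
  refine add_lt_add_of_le_of_lt (Finset.sum_le_sum fun v hv => ?_) ?_
  · exact Nat.pow_le_pow_right hN0 (hab v (Finset.mem_filter.1 hv).2)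
  · calc ∑ v with ¬ m < a v, N ^ a v ≤ ∑ v with ¬ m < a v, N ^ m :=
          Finset.sum_le_sum fun v hv =>
            Nat.pow_le_pow_right hN0 (not_lt.1 (Finset.mem_filter.1 hv).2)
      _ ≤ Fintype.card α * N ^ m := by
          rw [Finset.sum_const, smul_eq_mul]
          exact Nat.mul_le_mul_right _ (Finset.card_le_univ _)
      _ < N * N ^ m := Nat.mul_lt_mul_of_pos_right (Nat.lt_succ_self _) (Nat.pow_pos hN0)
      _ = N ^ (m + 1) := (pow_succ' N m).symm
      _ ≤ N ^ b y := Nat.pow_le_pow_right hN0 hy'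
      _ ≤ ∑ v with ¬ m < a v, N ^ b v :=
          Finset.single_le_sum (f := fun v => N ^ b v) (fun _ _ => Nat.zero_le _)
            (Finset.mem_filter.2 ⟨Finset.mem_univ y, not_lt.2 hy⟩)

/-- If a path avoiding the neighbourhood of `s` met a neighbour of `z`, it could be diverted to `z`,
putting `z` in the component. -/
theorem avoidingComponent_subset {G : SimpleGraph V} {s z v : V} (hzs : ¬ G.Adj z s)
    (h : z ∉ avoidingComponent G s v) : avoidingComponent G s v ⊆ avoidingComponent G z v := by
  classical
  rintro t ⟨P, hP, hav⟩
  refine ⟨P, hP, fun p hp hzp => h ?_⟩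
  have : PathAvoiding G v p s := .of_walk (P.takeUntil p hp) fun q hq =>
    hav q (P.support_takeUntil_subset_support hp hq)
  exact this.trans (.cons (hav p hp) hzp.symm (.refl fun h => hzs h.symm))

theorem avoidingComponent_eq {G : SimpleGraph V} {s v z : V} (h : z ∈ avoidingComponent G s v) :
    avoidingComponent G s v = avoidingComponent G s z :=
  Set.ext fun _ => ⟨fun ht => PathAvoiding.trans (PathAvoiding.symm h) ht,
    fun ht => PathAvoiding.trans h ht⟩

/-- In a finite graph without asteroidal triples, every component contains a vertex with respect to
which no two vertices are unrelated. -/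
theorem exists_reachable_not_unrelated [Finite V] {G : SimpleGraph V}
    (hG : ¬ ∃ u v w, IsAsteroidalTriple G u v w) (v₀ : V) :
    ∃ s, G.Reachable v₀ s ∧ ∀ y z, ¬ Unrelated G s y z := by
  classical
  have := Fintype.ofFinite V
  let Φ : V → ℕ := fun s => ∑ v, (Fintype.card V + 1) ^ (avoidingComponent G s v).ncard
  obtain ⟨s, hs, hmax⟩ := Finset.exists_max_image (Finset.univ.filter (G.Reachable v₀)) Φ
    ⟨v₀, by simp⟩
  simp only [Finset.mem_filter, Finset.mem_univ, true_and] at hs hmax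
  have key : ∀ y z, Unrelated G s y z →
      -- Otherwise `z` would beat `s`: every component larger than that of `y` misses `z` and
      -- survives, while that of `y` grows strictly because it gains `s`. It misses `z` too, or `y`,
      -- `z`, `s` would be an asteroidal triple.
      ¬ (avoidingComponent G s z).ncard ≤ (avoidingComponent G s y).ncard := by
    rintro y z ⟨hyz, hys, hzs, hy, hz⟩ hle
    refine (hmax z (hs.trans hz.reachable.symm)).not_gt ?_
    have hsub : ∀ v, z ∉ avoidingComponent G s v →
        avoidingComponent G s v ⊆ avoidingComponent G z v := fun v =>
      avoidingComponent_subset hy.not_adj_right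
    refine sum_pow_lt_sum_pow _ _ (avoidingComponent G s y).ncard (fun v hv => ?_) y le_rfl ?_
    · refine Set.ncard_le_ncard (hsub v fun h => ?_) (Set.toFinite _)
      rw [avoidingComponent_eq h] at hv
      omega
    · refine Set.ncard_lt_ncard ⟨hsub y fun h => hG ⟨y, z, s, hyz, hzs, hys, h, hz, hy.symm⟩,
        fun h => ?_⟩ (Set.toFinite _)
      have hsy : PathAvoiding G y s s := h hy
      obtain ⟨t, hst, hst'⟩ := hsy.symm.exists_adj hys.symm
      exact hst' hst
  refine ⟨s, hs, fun y z h => ?_⟩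
  rcases le_total (avoidingComponent G s z).ncard (avoidingComponent G s y).ncard with hle | hle
  · exact key y z h hle
  · exact key z y ⟨h.1.symm, h.2.2.1, h.2.1, h.2.2.2.2, h.2.2.2.1⟩ hle

/-! ### Breadth-first levels -/

/-- The vertices adjacent to `v` and one step farther from the root of their component. -/
def upNeighbors (G : SimpleGraph V) (root : V → V) (v : V) : Set V :=
  {a | G.Adj v a ∧ G.dist (root a) a = G.dist (root v) v + 1}

/-- The vertices adjacent to `v` and one step closer to the root of their component. -/
def downNeighbors (G : SimpleGraph V) (root : V → V) (v : V) : Set V :=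
  {a | G.Adj v a ∧ G.dist (root a) a + 1 = G.dist (root v) v}

theorem dist_le_succ_of_adj {G : SimpleGraph V} {s u v : V} (hs : G.Reachable s u)
    (h : G.Adj u v) : G.dist s v ≤ G.dist s u + 1 := by
  obtain ⟨P, hP⟩ := hs.exists_walk_length_eq_dist
  have := SimpleGraph.dist_le (P.append (.cons h .nil))
  simp only [SimpleGraph.Walk.length_append, SimpleGraph.Walk.length_cons,
    SimpleGraph.Walk.length_nil] at this
  omega

theorem exists_adj_dist_eq {G : SimpleGraph V} {s v : V} {k : ℕ} (h : G.dist s v = k + 1) :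
    ∃ u, G.Adj v u ∧ G.Reachable s u ∧ G.dist s u = k := by
  obtain ⟨P, hP⟩ := SimpleGraph.exists_walk_of_dist_ne_zero (u := v) (v := s)
    (by rw [SimpleGraph.dist_comm, h]; omega)
  rw [SimpleGraph.dist_comm, h] at hP
  cases P with
  | nil => simp at hP
  | @cons _ u _ hadj P =>
    refine ⟨u, hadj, P.reachable.symm, le_antisymm ?_ ?_⟩
    · rw [SimpleGraph.dist_comm]
      have := SimpleGraph.dist_le P
      simp only [SimpleGraph.Walk.length_cons] at hP
      omega
    · have := dist_le_succ_of_adj P.reachable.symm hadj.symm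
      omega

/-- A shortest path from `v` to `s` avoids the neighbourhood of any vertex that is farther from `s`
and not adjacent to `v`. -/
theorem pathAvoiding_of_dist_lt {G : SimpleGraph V} {s w : V} (k : ℕ) : ∀ v, G.Reachable s v →
    G.dist s v = k → k < G.dist s w → ¬ G.Adj w v → PathAvoiding G v s w := by
  induction k with
  | zero =>
    intro v hv h _ hw
    obtain rfl := hv.dist_eq_zero_iff.1 h
    exact .refl hw
  | succ k ih =>
    intro v hv h hlt hw
    obtain ⟨u, hvu, hu, huk⟩ := exists_adj_dist_eq h
    refine .cons hw hvu (ih u hu huk (by omega) fun hwu => ?_)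
    have := dist_le_succ_of_adj hu hwu.symm
    omega

theorem even_dist_iff {G : SimpleGraph V} {X : Set V}
    (hX : ∀ u v, G.Adj u v → (u ∈ X ↔ v ∉ X)) {s v : V} (hs : G.Reachable s v) :
    Even (G.dist s v) ↔ (s ∈ X ↔ v ∈ X) := by
  classical
  let c : G.Coloring Bool := SimpleGraph.Coloring.mk (fun v => decide (v ∈ X)) fun {u v} h => by
    have := hX u v h
    simp only [ne_eq, decide_eq_decide]
    tauto
  obtain ⟨P, hP⟩ := hs.exists_walk_length_eq_dist
  rw [← hP, c.even_length_iff_congr P]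
  simp [c, SimpleGraph.Coloring.mk]

section Levels

variable {G : SimpleGraph V} {X : Set V} {root : V → V}

theorem dist_root_of_adj (hX : ∀ u v, G.Adj u v → (u ∈ X ↔ v ∉ X))
    (hroot : ∀ v, G.Reachable (root v) v) (hroot' : ∀ u v, G.Reachable u v → root u = root v)
    {u v : V} (h : G.Adj u v) : v ∈ upNeighbors G root u ∨ v ∈ downNeighbors G root u := by
  have hr := hroot' u v h.reachable
  have hu := hroot u
  have hv := hroot v
  rw [← hr] at hv
  have h1 := dist_le_succ_of_adj hu h
  have h2 := dist_le_succ_of_adj hv h.symm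
  have hne : G.dist (root u) u ≠ G.dist (root u) v := by
    intro he
    have h3 := even_dist_iff hX hu
    have h4 := even_dist_iff hX hv
    have h5 := hX u v h
    rw [he] at h3
    tauto
  simp only [upNeighbors, downNeighbors, Set.mem_ofPred_eq, h, true_and, ← hr]
  omega

variable (hX : ∀ u v, G.Adj u v → (u ∈ X ↔ v ∉ X)) (hroot : ∀ v, G.Reachable (root v) v)
  (hroot' : ∀ u v, G.Reachable u v → root u = root v)
  (hadm : ∀ v y z, ¬ Unrelated G (root v) y z)

include hX hroot hroot'

theorem not_adj_of_dist_root_eq {u v : V} (h : G.dist (root u) u = G.dist (root v) v) :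
    ¬ G.Adj u v := by
  intro hadj
  rcases dist_root_of_adj hX hroot hroot' hadj with h' | h'
  · have := h'.2; omega
  · have := h'.2; omega

include hadm

/-- Private up-neighbours `a` of `u` and `b` of `v` would be unrelated: each descends to the root
through its own parent. -/
theorem upNeighbors_comparable {u v : V} (hr : root u = root v)
    (h : G.dist (root u) u = G.dist (root v) v) :
    upNeighbors G root u ⊆ upNeighbors G root v ∨ upNeighbors G root v ⊆ upNeighbors G root u := by
  by_contra! hn
  obtain ⟨⟨a, hau, hav⟩, b, hbv, hbu⟩ := And.imp Set.not_subset.1 Set.not_subset.1 hn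
  have hav' : ¬ G.Adj v a := fun hh => hav ⟨hh, by rw [← h]; exact hau.2⟩
  have hbu' : ¬ G.Adj u b := fun hh => hbu ⟨hh, by rw [h]; exact hbv.2⟩
  have hra := hroot' u a hau.1.reachable
  have hrb := hroot' v b hbv.1.reachable
  have hda := hau.2
  have hdb := hbv.2
  have hru := hroot u
  have hrv := hroot v
  have hab := not_adj_of_dist_root_eq hX hroot hroot' (u := a) (v := b) (by omega)
  rw [← hra] at hda
  rw [← hrb, ← hr] at hdb
  rw [← hr] at hrv h
  refine hadm u a b ⟨?_, ?_, ?_, ?_, ?_⟩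
  · rintro rfl; exact hbu' hau.1
  · intro ha
    rw [ha, SimpleGraph.dist_self] at hda
    omega
  · intro hb
    rw [hb, SimpleGraph.dist_self] at hdb
    omega
  · exact .cons (fun hh => hab hh.symm) hau.1.symm
      (pathAvoiding_of_dist_lt _ u hru rfl (by omega) fun hh => hbu' hh.symm)
  · exact .cons hab hbv.1.symm
      (pathAvoiding_of_dist_lt _ v hrv rfl (by omega) fun hh => hav' hh.symm)

/-- Private down-neighbours `a` and `b` would have incomparable up-neighbourhoods, separated by `u`
and `v`. -/
theorem downNeighbors_comparable {u v : V} (hr : root u = root v)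
    (h : G.dist (root u) u = G.dist (root v) v) :
    downNeighbors G root u ⊆ downNeighbors G root v ∨
      downNeighbors G root v ⊆ downNeighbors G root u := by
  by_contra! hn
  obtain ⟨⟨a, hau, hav⟩, b, hbv, hbu⟩ := And.imp Set.not_subset.1 Set.not_subset.1 hn
  have hav' : ¬ G.Adj v a := fun hh => hav ⟨hh, by rw [← h]; exact hau.2⟩
  have hbu' : ¬ G.Adj u b := fun hh => hbu ⟨hh, by rw [h]; exact hbv.2⟩
  have hra := hroot' u a hau.1.reachable
  have hrb := hroot' v b hbv.1.reachable
  have hda := hau.2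
  have hdb := hbv.2
  rcases upNeighbors_comparable hX hroot hroot' hadm (u := a) (v := b)
    (by rw [← hra, hr, hrb]) (by omega) with hs | hs
  · exact hbu' (hs (show u ∈ upNeighbors G root a from ⟨hau.1.symm, hda.symm⟩)).1.symm
  · exact hav' (hs (show v ∈ upNeighbors G root b from ⟨hbv.1.symm, hdb.symm⟩)).1.symm

/-- If `u` had a private neighbour `a` above and a private neighbour `b` below, then `a` and `v`
would be unrelated: `a` reaches the root through `u` and `b`. -/
theorem upNeighbors_subset_or_downNeighbors_subset {u v : V} (hr : root u = root v)
    (h : G.dist (root u) u = G.dist (root v) v) :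
    upNeighbors G root u ⊆ upNeighbors G root v ∨
      downNeighbors G root u ⊆ downNeighbors G root v := by
  by_contra! hn
  obtain ⟨⟨a, hau, hav⟩, b, hbu, hbv⟩ := And.imp Set.not_subset.1 Set.not_subset.1 hn
  have hav' : ¬ G.Adj v a := fun hh => hav ⟨hh, by rw [← h]; exact hau.2⟩
  have hbv' : ¬ G.Adj v b := fun hh => hbv ⟨hh, by rw [← h]; exact hbu.2⟩
  have huv := not_adj_of_dist_root_eq hX hroot hroot' h
  have hra := hroot' u a hau.1.reachable
  have hrb := hroot' u b hbu.1.reachable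
  have hda := hau.2
  have hdb := hbu.2
  have hrv := hroot v
  have hrb' := hroot b
  rw [← hra] at hda
  rw [← hrb] at hdb hrb'
  rw [← hr] at hrv h
  refine hadm u a v ⟨?_, ?_, ?_, ?_, ?_⟩
  · rintro rfl; omega
  · intro ha
    rw [ha, SimpleGraph.dist_self] at hda
    omega
  · intro hv
    rw [hv, SimpleGraph.dist_self] at h
    omega
  · exact .cons hav' hau.1.symm (.cons (fun hh => huv hh.symm) hbu.1
      (pathAvoiding_of_dist_lt _ b hrb' rfl (by omega) hbv'))
  · exact pathAvoiding_of_dist_lt _ v hrv rfl (by omega) fun hh => hav' hh.symm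

theorem upNeighbors_subset_and_downNeighbors_subset_or {u v : V} (hr : root u = root v)
    (h : G.dist (root u) u = G.dist (root v) v) :
    (upNeighbors G root u ⊆ upNeighbors G root v ∧
        downNeighbors G root v ⊆ downNeighbors G root u) ∨
      (upNeighbors G root v ⊆ upNeighbors G root u ∧
        downNeighbors G root u ⊆ downNeighbors G root v) := by
  have h₁ := upNeighbors_comparable hX hroot hroot' hadm hr h
  have h₂ := downNeighbors_comparable hX hroot hroot' hadm hr h
  have h₃ := upNeighbors_subset_or_downNeighbors_subset hX hroot hroot' hadm hr h
  have h₄ := upNeighbors_subset_or_downNeighbors_subset hX hroot hroot' hadm hr.symm h.symm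
  tauto

/-- Since the inclusions run in opposite directions, up-degree minus down-degree sorts each level by
them. -/
theorem upNeighbors_subset_and_downNeighbors_subset [Finite V] {u v : V} (hr : root u = root v)
    (h : G.dist (root u) u = G.dist (root v) v)
    (hle : (upNeighbors G root u).ncard + (downNeighbors G root v).ncard ≤
      (upNeighbors G root v).ncard + (downNeighbors G root u).ncard) :
    upNeighbors G root u ⊆ upNeighbors G root v ∧
      downNeighbors G root v ⊆ downNeighbors G root u := by
  rcases upNeighbors_subset_and_downNeighbors_subset_or hX hroot hroot' hadm hr h with h' | h'
  · exact h'
  · have h₁ := Set.ncard_le_ncard h'.1 (Set.toFinite _)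
    have h₂ := Set.ncard_le_ncard h'.2 (Set.toFinite _)
    exact ⟨(Set.eq_of_subset_of_ncard_le h'.1 (by omega) (Set.toFinite _)).symm.subset,
      (Set.eq_of_subset_of_ncard_le h'.2 (by omega) (Set.toFinite _)).symm.subset⟩

end Levels

theorem hasStrongOrdering_of_not_exists_isAsteroidalTriple [Finite V] {G : SimpleGraph V}
    {X Y : Set V} (hG : G.IsBipartiteWith X Y)
    (hAT : ¬ ∃ u v w, IsAsteroidalTriple G u v w) : HasStrongOrdering G X Y := by
  classical
  have hX : ∀ u v, G.Adj u v → (u ∈ X ↔ v ∉ X) := by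
    intro u v h
    have h1 : u ∈ X → u ∉ Y := fun h => Set.disjoint_left.1 hG.disjoint h
    have h2 : v ∈ X → v ∉ Y := fun h => Set.disjoint_left.1 hG.disjoint h
    have := hG.mem_of_adj h
    tauto
  have hex : ∀ c : G.ConnectedComponent, ∃ s, G.connectedComponentMk s = c ∧
      ∀ y z, ¬ Unrelated G s y z := by
    intro c
    obtain ⟨v, rfl⟩ := c.exists_rep
    obtain ⟨s, hs, h⟩ := exists_reachable_not_unrelated hAT v
    exact ⟨s, (SimpleGraph.ConnectedComponent.sound hs).symm, h⟩
  choose t ht hadm' using hex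
  let root : V → V := fun v => t (G.connectedComponentMk v)
  have hroot : ∀ v, G.Reachable (root v) v := fun v =>
    SimpleGraph.ConnectedComponent.exact (ht _)
  have hroot' : ∀ u v, G.Reachable u v → root u = root v := fun u v h =>
    congrArg t (SimpleGraph.ConnectedComponent.sound h)
  have hadm : ∀ v y z, ¬ Unrelated G (root v) y z := fun v => hadm' _
  let ℓ : V → ℕ := fun v => G.dist (root v) v
  let U := upNeighbors G root
  let D := downNeighbors G root
  let e := Finite.equivFin V
  let φ : V → ℤ := fun v => (U v).ncard - (D v).ncard
  have hφ : ∀ u v, root u = root v → ℓ u = ℓ v → φ u ≤ φ v → U u ⊆ U v ∧ D v ⊆ D u := by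
    intro u v hr hl hle
    refine upNeighbors_subset_and_downNeighbors_subset hX hroot hroot' hadm hr hl ?_
    simp only [φ, U, D] at hle
    omega
  have hpar : ∀ u v, root u = root v → (u ∈ X ↔ v ∈ X) → (Even (ℓ u) ↔ Even (ℓ v)) := by
    intro u v hr huv
    have h1 := even_dist_iff hX (hroot u)
    have h2 := even_dist_iff hX (hroot v)
    rw [← hr] at h2
    simp only [ℓ]
    rw [← hr]
    tauto
  have hUD : ∀ u v, v ∈ U u ↔ u ∈ D v := fun u v =>
    ⟨fun h => ⟨h.1.symm, h.2.symm⟩, fun h => ⟨h.1.symm, h.2.symm⟩⟩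
  have hU : ∀ u v, v ∈ U u → ℓ v = ℓ u + 1 := fun u v h => h.2
  have hD : ∀ u v, v ∈ D u → ℓ v + 1 = ℓ u := fun u v h => h.2
  have hadj : ∀ u v, G.Adj u v → v ∈ U u ∨ v ∈ D u := fun u v h =>
    dist_root_of_adj hX hroot hroot' h
  refine hasStrongOrdering_of_key (fun v => toLex (e (root v), toLex (ℓ v, φ v))) ?_
  intro x hx x' hx' y hy y' hy' hxy hxy' hxx hyy
  simp only [Prod.Lex.toLex_le_toLex] at hxx hyy
  have hrxy := hroot' x y hxy.reachable
  have hrxy' := hroot' x' y' hxy'.reachable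
  have hrx : root x = root x' := by
    rw [← hrxy, ← hrxy'] at hyy
    apply e.injective
    have h1 : e (root x) ≤ e (root x') := hxx.elim le_of_lt fun h => h.1.le
    have h2 : e (root x') ≤ e (root x) := hyy.elim le_of_lt fun h => h.1.le
    exact le_antisymm h1 h2
  have hry : root y = root y' := by rw [← hrxy, hrx, hrxy']
  simp only [hrx, hry, lt_self_iff_false, false_or, true_and] at hxx hyy
  have hxx' : ℓ x = ℓ x' → U x ⊆ U x' ∧ D x' ⊆ D x := fun he =>
    hφ x x' hrx he (by rcases hxx with h | h; exacts [(h.ne he).elim, h.2])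
  have hyy' : ℓ y' = ℓ y → U y' ⊆ U y ∧ D y ⊆ D y' := fun he =>
    hφ y' y hry.symm he (by rcases hyy with h | h; exacts [(h.ne he).elim, h.2])
  have hlx : ℓ x ≤ ℓ x' := hxx.elim le_of_lt fun h => h.1.le
  have hly : ℓ y' ≤ ℓ y := hyy.elim le_of_lt fun h => h.1.le
  have hparx := hpar x x' hrx (by tauto)
  simp only [Nat.even_iff] at hparx
  -- Crossing edges span nearly the same levels. By parity, `x` and `x'` share a level or `y` and
  -- `y'` do, and the nested neighbourhoods supply the missing edges; a first edge going down with a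
  -- second going up is impossible.
  rcases hadj x y hxy with h₁ | h₁ <;> rcases hadj x' y' hxy' with h₂ | h₂
  · have := hU _ _ h₁
    have := hU _ _ h₂
    have hex := hxx' (by omega)
    have hey := hyy' (by omega)
    exact ⟨((hUD _ _).2 (hey.2 ((hUD _ _).1 h₁))).1, (hex.1 h₁).1⟩
  · have := hU _ _ h₁
    have := hD _ _ h₂
    rcases hlx.eq_or_lt with he | hlt
    · have hex := hxx' he
      exact ⟨(hex.2 h₂).1, (hex.1 h₁).1⟩
    · have hey := hyy' (by omega)
      exact ⟨(hey.2 ((hUD _ _).1 h₁)).1.symm, (hey.1 ((hUD _ _).2 h₂)).1.symm⟩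
  · have := hD _ _ h₁
    have := hU _ _ h₂
    omega
  · have := hD _ _ h₁
    have := hD _ _ h₂
    have hex := hxx' (by omega)
    have hey := hyy' (by omega)
    exact ⟨(hex.2 h₂).1, ((hUD _ _).1 (hey.1 ((hUD _ _).2 h₂))).1⟩

/-! ### Arcs of a circle -/

theorem coe_eq_coe_iff_exists_add (x y : ℝ) :
    (x : UnitAddCircle) = y ↔ ∃ n : ℤ, x + n = y := by
  rw [eq_comm, ← sub_eq_zero, ← AddCircle.coe_sub, AddCircle.coe_eq_zero_iff]
  refine exists_congr fun n => ?_
  rw [zsmul_one]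
  constructor <;> intro h <;> linarith

theorem coe_mem_arc_iff {a b x : ℝ} :
    (x : UnitAddCircle) ∈ arc a b ↔ ∃ n : ℤ, a ≤ x + n ∧ x + n ≤ b := by
  constructor
  · rintro ⟨y, hy, hxy⟩
    obtain ⟨n, hn⟩ := (coe_eq_coe_iff_exists_add x y).1 hxy.symm
    exact ⟨n, hn ▸ hy.1, hn ▸ hy.2⟩
  · rintro ⟨n, h₁, h₂⟩
    exact ⟨x + n, ⟨h₁, h₂⟩, ((coe_eq_coe_iff_exists_add _ _).2 ⟨n, rfl⟩).symm⟩

theorem arc_inter_arc_nonempty_iff {a b c d : ℝ} (hab : a ≤ b) (hcd : c ≤ d) :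
    (arc a b ∩ arc c d).Nonempty ↔ ∃ n : ℤ, a ≤ d + n ∧ c + n ≤ b := by
  constructor
  · rintro ⟨_, ⟨x, hx, rfl⟩, hx'⟩
    obtain ⟨n, h₁, h₂⟩ := coe_mem_arc_iff.1 hx'
    refine ⟨-n, ?_, ?_⟩ <;> push_cast <;> linarith [hx.1, hx.2]
  · rintro ⟨n, h₁, h₂⟩
    refine ⟨(max a (c + n) : ℝ), coe_mem_arc_iff.2 ⟨0, ?_, ?_⟩, coe_mem_arc_iff.2 ⟨-n, ?_, ?_⟩⟩
    · simp
    · simp [hab, h₂]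
    · have := le_max_right a (c + n)
      push_cast
      linarith
    · have : max a (c + n) ≤ d + n := max_le h₁ (by linarith)
      push_cast
      linarith

theorem arc_subset_arc {a b c d : ℝ} (n : ℤ) (h₁ : c + n ≤ a) (h₂ : b ≤ d + n) :
    arc a b ⊆ arc c d := by
  rintro _ ⟨x, hx, rfl⟩
  refine coe_mem_arc_iff.2 ⟨-n, ?_, ?_⟩ <;> push_cast <;> linarith [hx.1, hx.2]

theorem left_mem_or_right_mem_of_inter_nonempty {a b c d : ℝ} (hab : a ≤ b) (hcd : c ≤ d)
    (h : (arc a b ∩ arc c d).Nonempty) (hss : ¬ arc a b ⊂ arc c d) :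
    (c : UnitAddCircle) ∈ arc a b ∨ (d : UnitAddCircle) ∈ arc a b := by
  obtain ⟨n, h₁, h₂⟩ := (arc_inter_arc_nonempty_iff hab hcd).1 h
  by_cases hd : d + n ≤ b
  · exact Or.inr (coe_mem_arc_iff.2 ⟨n, h₁, hd⟩)
  by_cases hc : a ≤ c + n
  · exact Or.inl (coe_mem_arc_iff.2 ⟨n, hc, h₂⟩)
  have hsub : arc a b ⊆ arc c d := arc_subset_arc n (not_le.1 hc).le (not_le.1 hd).le
  have hsub' : arc c d ⊆ arc a b := by
    by_contra h'
    exact hss ⟨hsub, h'⟩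
  exact Or.inr (hsub' ⟨d, ⟨hcd, le_rfl⟩, rfl⟩)

theorem right_mem_or_right_mem_of_inter_nonempty {a b c d : ℝ} (hab : a ≤ b) (hcd : c ≤ d)
    (h : (arc a b ∩ arc c d).Nonempty) :
    (d : UnitAddCircle) ∈ arc a b ∨ (b : UnitAddCircle) ∈ arc c d := by
  obtain ⟨n, h₁, h₂⟩ := (arc_inter_arc_nonempty_iff hab hcd).1 h
  by_cases hd : d + n ≤ b
  · exact Or.inl (coe_mem_arc_iff.2 ⟨n, h₁, hd⟩)
  · refine Or.inr (coe_mem_arc_iff.2 ⟨-n, ?_, ?_⟩) <;> push_cast <;> linarith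

theorem subset_or_subset_or_union_eq_univ {a b c d : ℝ}
    (h₁ : (d : UnitAddCircle) ∈ arc a b) (h₂ : (b : UnitAddCircle) ∈ arc c d) :
    arc a b ⊆ arc c d ∨ arc c d ⊆ arc a b ∨ arc a b ∪ arc c d = Set.univ := by
  obtain ⟨n, hn₁, hn₂⟩ := coe_mem_arc_iff.1 h₁
  obtain ⟨m, hm₁, hm₂⟩ := coe_mem_arc_iff.1 h₂
  have hle : m + n ≤ 0 := by
    have : ((m + n : ℤ) : ℝ) ≤ 0 := by push_cast; linarith
    exact_mod_cast this
  rcases hle.eq_or_lt with he | hlt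
  · have he' : (m : ℝ) + n = 0 := by exact_mod_cast he
    rcases le_total a (c + n) with h | h
    · right; left
      refine arc_subset_arc (-n) ?_ ?_ <;> push_cast <;> linarith
    · left
      exact arc_subset_arc n h (by linarith)
  -- The lift of the second arc by `n` starts at or before `b - 1` and ends at or after `a`, so with
  -- `[a, b]` it covers a full turn ending at `b`.
  · have hlt' : (m : ℝ) + n ≤ -1 := by
      have : m + n ≤ -1 := by omega
      exact_mod_cast this
    right; right
    refine Set.eq_univ_of_forall fun p => ?_
    obtain ⟨x, rfl⟩ := QuotientAddGroup.mk_surjective p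
    have hx₁ := Int.floor_le (b - x)
    have hx₂ := Int.lt_floor_add_one (b - x)
    by_cases hx : a ≤ x + ⌊b - x⌋
    · exact Or.inl (coe_mem_arc_iff.2 ⟨⌊b - x⌋, hx, by linarith⟩)
    · refine Or.inr (coe_mem_arc_iff.2 ⟨⌊b - x⌋ - n, ?_, ?_⟩) <;> push_cast <;> linarith

theorem not_arc_ssubset_arc_of_length_eq {a b l : ℝ} (hl : 0 ≤ l) (hl' : l < 1 / 2) :
    ¬ arc a (a + l) ⊂ arc b (b + l) := by
  rintro ⟨h, h'⟩
  refine h' ?_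
  obtain ⟨n, hn₁, hn₂⟩ := coe_mem_arc_iff.1 (h ⟨a, ⟨le_rfl, by linarith⟩, rfl⟩)
  obtain ⟨m, hm₁, hm₂⟩ := coe_mem_arc_iff.1 (h ⟨a + l, ⟨by linarith, le_rfl⟩, rfl⟩)
  have hmn : m = n := by
    have h₁ : ((m - n : ℤ) : ℝ) < 1 := by push_cast; linarith
    have h₂ : (-1 : ℝ) < ((m - n : ℤ) : ℝ) := by push_cast; linarith
    have h₃ : m - n < 1 := by exact_mod_cast h₁
    have h₄ : -1 < m - n := by exact_mod_cast h₂
    omega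
  subst hmn
  refine arc_subset_arc m ?_ ?_ <;> linarith

/-! ### Proper circular arc graphs -/

theorem UnitCoord.isProperCircularArcGraph_compl [Finite V] {G : SimpleGraph V} {X Y : Set V}
    (hG : G.IsBipartiteWith X Y) (hXY : X ∪ Y = Set.univ) (c : UnitCoord G X Y) :
    IsProperCircularArcGraph Gᶜ := by
  classical
  have hdisj : ∀ v, v ∈ X → v ∉ Y := fun _ h => Set.disjoint_left.1 hG.disjoint h
  have hmem : ∀ v, v ∈ X ∨ v ∈ Y := fun v => by
    rw [← Set.mem_union, hXY]; trivial
  obtain ⟨ε, hε, hε', hbound⟩ : ∃ ε : ℝ, 0 < ε ∧ ε ≤ 1 / 8 ∧ ∀ v, |ε * c.coord v| ≤ 1 / 8 := by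
    obtain ⟨M, hM⟩ := (Set.finite_range fun v => |c.coord v|).bddAbove
    have hM' : ∀ v, |c.coord v| ≤ |M| := fun v => (hM ⟨v, rfl⟩).trans (le_abs_self M)
    have hpos : 0 < |M| + 1 := by positivity
    refine ⟨1 / (8 * (|M| + 1)), by positivity, ?_, fun v => ?_⟩
    · rw [div_le_div_iff₀ (by positivity) (by norm_num)]
      linarith [abs_nonneg M]
    · rw [abs_mul, abs_of_pos (by positivity), div_mul_eq_mul_div,
        div_le_div_iff₀ (by positivity) (by norm_num)]
      linarith [hM' v]
  have hb : ∀ v, -(1 / 8) ≤ ε * c.coord v ∧ ε * c.coord v ≤ 1 / 8 := fun v => abs_le.1 (hbound v)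
  -- The two parts occupy nearly complementary half circles, perturbed by the scaled coordinates.
  -- Arcs `x` and `y` can meet at two places, near `1/4` when `y` exceeds `x` by at least `1` and
  -- near `3/4` when `x` exceeds `y` by at least `1`; these are `n = 0` and `n = -1`.
  let a : V → ℝ := fun v => (if v ∈ X then -(1 / 4) else 1 / 4) - ε * c.coord v
  have haX : ∀ v ∈ X, a v = -(1 / 4) - ε * c.coord v := fun v hv => by simp [a, hv]
  have haY : ∀ v ∈ Y, a v = 1 / 4 - ε * c.coord v := fun v hv => by
    have : v ∉ X := fun h => hdisj v h hv
    simp [a, this]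
  have hmeet : ∀ u v, (arc (a u) (a u + (1 / 2 - ε)) ∩ arc (a v) (a v + (1 / 2 - ε))).Nonempty ↔
      ∃ n : ℤ, a u ≤ a v + (1 / 2 - ε) + n ∧ a v + n ≤ a u + (1 / 2 - ε) := fun u v =>
    arc_inter_arc_nonempty_iff (by linarith) (by linarith)
  have hcross : ∀ x ∈ X, ∀ y ∈ Y, (¬ G.Adj x y ↔
      (arc (a x) (a x + (1 / 2 - ε)) ∩ arc (a y) (a y + (1 / 2 - ε))).Nonempty) := by
    intro x hx y hy
    rw [hmeet, c.adj_iff x hx y hy, not_lt, le_abs, haX x hx, haY y hy]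
    have hbx := hb x
    have hby := hb y
    constructor
    · rintro (h | h)
      · have := mul_le_mul_of_nonneg_left h hε.le
        refine ⟨-1, ?_, ?_⟩ <;> push_cast <;> linarith
      · have := mul_le_mul_of_nonneg_left h hε.le
        refine ⟨0, ?_, ?_⟩ <;> push_cast <;> linarith
    · rintro ⟨n, h₁, h₂⟩
      have hn₁ : n < 1 := by
        have : (n : ℝ) < 1 := by linarith
        exact_mod_cast this
      have hn₂ : -2 < n := by
        have : (-2 : ℝ) < n := by linarith
        exact_mod_cast this
      obtain rfl | rfl : n = 0 ∨ n = -1 := by omega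
      · right
        push_cast at h₁ h₂
        refine le_of_mul_le_mul_left ?_ hε
        linarith
      · left
        push_cast at h₁ h₂
        refine le_of_mul_le_mul_left ?_ hε
        linarith
  refine ⟨a, fun v => a v + (1 / 2 - ε), fun v => ⟨by linarith, by linarith⟩, fun u v => ?_,
    fun u v => not_arc_ssubset_arc_of_length_eq (by linarith) (by linarith)⟩
  rw [SimpleGraph.compl_adj]
  refine and_congr_right fun huv => ?_
  rcases hmem u with hu | hu <;> rcases hmem v with hv | hv
  · have hn : ¬ G.Adj u v := fun h => by
      have := hG.mem_of_adj h
      have := hdisj u hu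
      have := hdisj v hv
      tauto
    refine iff_of_true hn ((hmeet u v).2 ⟨0, ?_, ?_⟩) <;> rw [haX u hu, haX v hv] <;>
      push_cast <;> linarith [hb u, hb v]
  · exact hcross u hu v hv
  · rw [G.adj_comm, Set.inter_comm]
    exact hcross v hv u hu
  · have hn : ¬ G.Adj u v := fun h => by
      have := hG.mem_of_adj h
      have := hdisj u
      have := hdisj v
      tauto
    refine iff_of_true hn ((hmeet u v).2 ⟨0, ?_, ?_⟩) <;> rw [haY u hu, haY v hv] <;>
      push_cast <;> linarith [hb u, hb v]

/-- Along a path avoiding the neighbourhood of `w`, consecutive arcs are disjoint and contain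
opposite ends of the arc of `w`, so containing the right end alternates with the part. Between two
vertices of a triple, exactly one arc contains the right end of the other. Adding these parities
around the triple is contradictory: each part occurs twice, while the three pairs contribute an odd
total. -/
theorem IsProperCircularArcGraph.not_exists_isAsteroidalTriple {G : SimpleGraph V} {X Y : Set V}
    (hG : G.IsBipartiteWith X Y) (h : IsProperCircularArcGraph Gᶜ) :
    ¬ ∃ u v w, IsAsteroidalTriple G u v w := by
  have parity : ∀ {p q r x y z : Prop}, ((¬ p ↔ x) ↔ (q ↔ y)) → ((¬ r ↔ y) ↔ (p ↔ z)) →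
      ((¬ q ↔ z) ↔ (r ↔ x)) → False := by
    intro p q r x y z
    by_cases p <;> by_cases q <;> by_cases r <;> by_cases x <;> by_cases y <;> simp_all
  obtain ⟨a, b, hab, hadj, hproper⟩ := h
  have hX : ∀ u v, G.Adj u v → (u ∈ X ↔ v ∉ X) := by
    intro u v h
    have h1 : u ∈ X → u ∉ Y := fun h => Set.disjoint_left.1 hG.disjoint h
    have h2 : v ∈ X → v ∉ Y := fun h => Set.disjoint_left.1 hG.disjoint h
    have := hG.mem_of_adj h
    tauto
  let A : V → Set UnitAddCircle := fun v => arc (a v) (b v)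
  have hmeet : ∀ u v, u ≠ v → ¬ G.Adj u v → (A u ∩ A v).Nonempty := fun u v huv h =>
    ((hadj u v).1 ((G.compl_adj u v).2 ⟨huv, h⟩)).2
  have hdis : ∀ u v, G.Adj u v → ∀ p ∈ A u, p ∉ A v := fun u v h p hp hp' =>
    ((G.compl_adj u v).1 ((hadj u v).2 ⟨h.ne, p, hp, hp'⟩)).2 h
  have hend : ∀ v, (b v : UnitAddCircle) ∈ A v := fun v => ⟨b v, ⟨(hab v).1, le_rfl⟩, rfl⟩
  let β : V → V → Prop := fun w z => (b w : UnitAddCircle) ∈ A z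
  have hside : ∀ w z, w ≠ z → ¬ G.Adj w z → (a w : UnitAddCircle) ∈ A z ∨ β w z := fun w z hwz h =>
    left_mem_or_right_mem_of_inter_nonempty (hab z).1 (hab w).1
      (hmeet z w hwz.symm fun h' => h h'.symm) (hproper z w)
  have hstep : ∀ w z z', G.Adj z z' → ¬ G.Adj w z → ¬ G.Adj w z' → (β w z ↔ ¬ β w z') := by
    intro w z z' hzz hz hz'
    have hwz : w ≠ z := by rintro rfl; exact hz' hzz
    have hwz' : w ≠ z' := by rintro rfl; exact hz hzz.symm
    refine ⟨fun h => hdis z z' hzz _ h, fun h => ?_⟩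
    refine (hside w z hwz hz).resolve_left fun h' => ?_
    exact hdis z z' hzz _ h' ((hside w z' hwz' hz').resolve_right h)
  have hpath : ∀ u v w, PathAvoiding G u v w → ((β w u ↔ u ∈ X) ↔ (β w v ↔ v ∈ X)) := by
    intro u v w h
    refine h.induction (fun z => (β w u ↔ u ∈ X) ↔ (β w z ↔ z ∈ X)) ?_ Iff.rfl
    intro z z' hzz hz hz' hu
    have h1 := hstep w z z' hzz hz hz'
    have h2 := hX z z' hzz
    rw [hu, h1, h2]
    tauto
  -- If each arc contained the right end of the other, they would be nested, hence equal, or cover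
  -- the circle. A neighbour `u'` of `u` not adjacent to `v` excludes both: its arc misses that of
  -- `u`, meets that of `v`, and is not properly contained in it.
  have hanti : ∀ u v w, PathAvoiding G u w v → u ≠ w → u ≠ v → (β u v ↔ ¬ β v u) := by
    intro u v w h huw huv
    obtain ⟨u', huu', hvu'⟩ := h.exists_adj huw
    have hvu := h.not_adj_left
    have hvu'' : v ≠ u' := by rintro rfl; exact hvu huu'.symm
    obtain ⟨p, hpv, hpu'⟩ := hmeet v u' hvu'' hvu'
    obtain ⟨p', hpu, hpv'⟩ := hmeet u v huv fun h => hvu h.symm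
    have hss : ∀ s t, A s ⊆ A t → A t ⊆ A s := fun s t hst => by
      by_contra h'
      exact hproper s t ⟨hst, h'⟩
    constructor
    · intro h₁ h₂
      rcases subset_or_subset_or_union_eq_univ h₂ h₁ with hs | hs | hs
      · exact hdis u u' huu' p (hss _ _ hs hpv) hpu'
      · exact hdis u u' huu' p (hs hpv) hpu'
      · have hsub : A u' ⊆ A v := fun q hq => by
          have hq' : q ∈ arc (a u) (b u) ∪ arc (a v) (b v) := hs ▸ Set.mem_univ q
          exact hq'.resolve_left fun hqu => hdis u u' huu' q hqu hq
        exact hdis u u' huu' p' hpu (hss _ _ hsub hpv')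
    · intro h₁
      exact (right_mem_or_right_mem_of_inter_nonempty (hab u).1 (hab v).1
        (hmeet u v huv fun h => hvu h.symm)).resolve_left h₁
  rintro ⟨u, v, w, huv, hvw, huw, h₁, h₂, h₃⟩
  have e₁ := hpath u v w h₁
  have e₂ := hpath v w u h₂
  have e₃ := hpath w u v h₃
  have e₄ := hanti u v w h₃.symm huw huv
  have e₅ := hanti v w u h₁.symm huv.symm hvw
  have e₆ := hanti w u v h₂.symm hvw.symm huw.symm
  rw [e₄] at e₂
  rw [e₅] at e₃
  rw [e₆] at e₁
  exact parity e₁ e₂ e₃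

end IntervalBigraph

/-! ### Assembly of the equivalences -/

open IntervalBigraph in
theorem theorem2p1 {V : Type*} [Finite V] (G : SimpleGraph V) (X Y : Set V)
    (hG : G.IsBipartiteWith X Y) (hXY : X ∪ Y = Set.univ) :
    List.TFAE
      [ IntervalBigraph.IsUnitIntervalBigraph G,
        IntervalBigraph.IsProperIntervalBigraph G,
        IntervalBigraph.IsClassProperIntervalGraph G 2,
        IntervalBigraph.IsPermutationGraph G,
        IntervalBigraph.HasUmbrellaOrdering G X Y,
        IntervalBigraph.HasStrongOrdering G X Y,
        IntervalBigraph.HasMonotoneConsecutiveArrangement (IntervalBigraph.biadjMatrix G X Y),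
        IntervalBigraph.IsComparabilityGraphOfDimLE G 2,
        IntervalBigraph.IsIncomparabilityGraphOfDimLE G 2,
        IntervalBigraph.IsProperCircularArcGraph Gᶜ,
        ¬ ∃ u v w, IntervalBigraph.IsAsteroidalTriple G u v w ] := by
  have coord : IsCocomparabilityGraph G → Nonempty (UnitCoord G X Y) :=
    fun h => h.nonempty_unitCoord hG
  tfae_have 1 → 2 := IsUnitIntervalBigraph.isProperIntervalBigraph
  tfae_have 2 → 3 := IsProperIntervalBigraph.isClassProperIntervalGraph
  tfae_have 3 → 4 := fun h => (coord h.isCocomparabilityGraph).elim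
    fun c => c.isPermutationGraph hG hXY
  tfae_have 4 → 5 := fun h => (coord h.isCocomparabilityGraph).elim
    fun c => c.hasUmbrellaOrdering hG hXY
  tfae_have 5 → 6 := fun h => h.hasStrongOrdering hG
  tfae_have 6 → 7 := fun h => h.hasMonotoneConsecutiveArrangement
  tfae_have 7 → 8 := fun h => (coord (h.isCocomparabilityGraph hG hXY)).elim
    fun c => c.isComparabilityGraphOfDimLE hG hXY
  tfae_have 8 → 9 := fun h => (coord h.isCocomparabilityGraph).elim
    fun c => c.isIncomparabilityGraphOfDimLE hG hXY
  tfae_have 9 → 10 := fun h => (coord h.isCocomparabilityGraph).elim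
    fun c => c.isProperCircularArcGraph_compl hG hXY
  tfae_have 10 → 11 := fun h => h.not_exists_isAsteroidalTriple hG
  tfae_have 11 → 6 := fun h => hasStrongOrdering_of_not_exists_isAsteroidalTriple hG h
  tfae_have 7 → 1 := fun h => (coord (h.isCocomparabilityGraph hG hXY)).elim
    fun c => c.isUnitIntervalBigraph hG hXY
  tfae_finish
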